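/- Let $G$ be a finite group with trivial center, and let $V=\bigoplus_{i=1}^n V_i$ and $W=\bigoplus_{j=1}^m W_j$ be finite-dimensional complex representations of $G$, where the $V_i$ and $W_j$ are irreducible. A (regular) covariant is a $G$-equivariant morphism $\phi\colon V\to W$ between finite-dimensional complex $G$-modules, and a rational covariant is a $G$-equivariant rational map $\phi\colon V\dashrightarrow W$ between such modules. Its dimension is $\dim\phi:=\dim\overline{\phi(V)}$, and it is faithful if $G$ acts faithfully on its image. Let $\operatorname{covdim}G$ (respectively $\operatorname{edim}G$) be the minimum of $\dim\phi$ over all faithful regular (respectively rational) covariants $\phi$ of $G$; a faithful regular (respectively rational) covariant that attains the minimum is called a minimal regular (respectively minimal rational) covariant. Let $\phi=(\phi_1,\dots,\phi_m)$ be a faithful covariant from $V$ to $W$, regular or rational, that is multihomogeneous of degree $A=(\alpha_{ji})\in M_{m\times n}(\mathbb Z)$, i.e. every component $\phi_j$ is nonzero and $$\phi_j(v_1,\dots,s v_i,\dots,v_n)=s^{\alpha_{ji}}\phi_j(v_1,\dots,v_n)\quad\text{for all } j=1,\dots,m,\ i=1,\dots,n \text{ and an indeterminate } s.$$ Then $$\operatorname{edim}G\le\dim\phi-\operatorname{rank}A\quad\text{and}\quad\operatorname{covdim}G\le\dim\phi-\operatorname{rank}A+1.$$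 In particular, if $G$ is non-trivial and $\phi$ is a minimal regular covariant, then $\operatorname{rank}A=1$; and if $\phi$ is a minimal rational covariant, then $A=0$. -/

import Mathlib

namespace CovDim

/-! ### Polynomial functions, the Zariski closure and its dimension

All vector spaces are finite dimensional over the field of complex numbers. -/

/-- The algebra `O(V)` of polynomial functions on a complex vector space `V`: the algebra of
functions on `V` that is generated by the linear forms. -/
def polyFun (V : Type*) [AddCommGroup V] [Module ℂ V] : Subalgebra ℂ (V → ℂ) :=
  Algebra.adjoin ℂ (Set.range fun l : Module.Dual ℂ V => (l : V → ℂ))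

/-- A morphism `V → W` of vector spaces (as varieties): a map all of whose linear coordinates
are polynomial functions. -/
def IsMorphism {V W : Type*} [AddCommGroup V] [Module ℂ V] [AddCommGroup W] [Module ℂ W]
    (f : V → W) : Prop :=
  ∀ l : Module.Dual ℂ W, (fun v => l (f v)) ∈ polyFun V

/-- The ideal of all polynomial functions on `W` that vanish on the subset `S`. -/
def idealOf {W : Type*} [AddCommGroup W] [Module ℂ W] (S : Set W) : Ideal (polyFun W) where
  carrier := {p | ∀ w ∈ S, (p : W → ℂ) w = 0}
  zero_mem' := fun _ _ => rfl
  add_mem' := fun {p q} hp hq w hw => by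
    change (p : W → ℂ) w + (q : W → ℂ) w = 0
    rw [hp w hw, hq w hw, add_zero]
  smul_mem' := fun c p hp w hw => by
    change (c : W → ℂ) w * (p : W → ℂ) w = 0
    rw [hp w hw, mul_zero]

/-- The Zariski closure of a subset `S` of the vector space `W`. -/
def zariskiClosure {W : Type*} [AddCommGroup W] [Module ℂ W] (S : Set W) : Set W :=
  {w | ∀ p ∈ idealOf S, (p : W → ℂ) w = 0}

/-- The dimension of the Zariski closure `X` of a nonempty subset `S` of `W`: the Krull dimension
of the coordinate ring `O(W) / I(X)`, which is a natural number by `coe_zariskiDim`. -/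
noncomputable def zariskiDim {W : Type*} [AddCommGroup W] [Module ℂ W] (S : Set W) : ℕ :=
  ((ringKrullDim (polyFun W ⧸ idealOf (zariskiClosure S))).unbotD 0).toNat

theorem coe_zariskiDim {W : Type*} [AddCommGroup W] [Module ℂ W] [FiniteDimensional ℂ W]
    {S : Set W} (hS : S.Nonempty) :
    (zariskiDim S : WithBot ℕ∞) = ringKrullDim (polyFun W ⧸ idealOf (zariskiClosure S)) := by
  obtain ⟨s, hs⟩ := hS
  have hne : idealOf (zariskiClosure S) ≠ ⊤ := by
    intro h
    have h1 : (1 : polyFun W) ∈ idealOf (zariskiClosure S) := by rw [h]; trivial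
    have h2 := h1 s (fun p hp => hp s hs)
    exact one_ne_zero (α := ℂ) h2
  have : Nontrivial (polyFun W ⧸ idealOf (zariskiClosure S)) :=
    Ideal.Quotient.nontrivial_iff.mpr hne
  let b := Module.finBasis ℂ W
  let n := Module.finrank ℂ W
  let F : MvPolynomial (Fin n) ℂ →ₐ[ℂ] (W → ℂ) := MvPolynomial.aeval fun i => (b.coord i : W → ℂ)
  have hr : polyFun W ≤ F.range := by
    refine Algebra.adjoin_le ?_
    rintro _ ⟨l, rfl⟩
    refine ⟨∑ i, MvPolynomial.C (l (b i)) * MvPolynomial.X i, ?_⟩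
    funext w
    have h := congrArg l (b.sum_repr w)
    rw [map_sum] at h
    refine Eq.trans ?_ h
    simp [F, Finset.sum_apply, mul_comm]
  have hl : ∀ p, F p ∈ polyFun W := by
    intro p
    have hp : F p ∈ F.range := ⟨p, rfl⟩
    rw [show F.range = Algebra.adjoin ℂ (Set.range fun i => (b.coord i : W → ℂ)) from
      (Algebra.adjoin_range_eq_range_aeval ℂ _).symm] at hp
    refine Algebra.adjoin_mono ?_ hp
    rintro _ ⟨i, rfl⟩
    exact ⟨b.coord i, rfl⟩
  let F' : MvPolynomial (Fin n) ℂ →ₐ[ℂ] polyFun W := F.codRestrict _ hl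
  have hF' : Function.Surjective F' := by
    rintro ⟨p, hp⟩
    obtain ⟨q, hq⟩ := hr hp
    exact ⟨q, Subtype.ext hq⟩
  have hle : ringKrullDim (polyFun W ⧸ idealOf (zariskiClosure S)) ≤ (n : WithBot ℕ∞) := by
    refine (ringKrullDim_le_of_surjective
      ((Ideal.Quotient.mk (idealOf (zariskiClosure S))).comp F'.toRingHom)
      (Ideal.Quotient.mk_surjective.comp hF')).trans ?_
    rw [MvPolynomial.ringKrullDim_of_isNoetherianRing]
    simp
  have h0 : (0 : WithBot ℕ∞) ≤ ringKrullDim (polyFun W ⧸ idealOf (zariskiClosure S)) :=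
    ringKrullDim_nonneg_of_nontrivial
  unfold zariskiDim
  generalize ringKrullDim (polyFun W ⧸ idealOf (zariskiClosure S)) = d at h0 hle
  induction d using WithBot.recBotCoe with
  | bot => simp at h0
  | coe d =>
    have hd : d ≤ (n : ℕ∞) := by exact_mod_cast hle
    have hd' : d ≠ ⊤ := ne_top_of_le_ne_top (ENat.natCast_ne_top n) hd
    lift d to ℕ using hd'
    simp

/-! ### Covariants -/

/-- A regular covariant of `G`: a `G`-equivariant morphism between the `G`-modules `ρ` and `σ`. -/
structure Covariant {G V W : Type*} [Group G] [AddCommGroup V] [Module ℂ V] [AddCommGroup W]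
    [Module ℂ W] (ρ : Representation ℂ G V) (σ : Representation ℂ G W) where
  toFun : V → W
  isMorphism : IsMorphism toFun
  equivariant : ∀ g v, toFun (ρ g v) = σ g (toFun v)

/-- A rational covariant of `G`: a `G`-equivariant rational map between the `G`-modules `ρ` and
`σ`, presented as a fraction `num / den` of a morphism by a nonzero polynomial function. Two
presentations that agree where both are defined present the same rational map; as the nonempty
open sets of `V` are dense, none of the notions below depends on the presentation. -/
structure RationalCovariant {G V W : Type*} [Group G] [AddCommGroup V] [Module ℂ V]
    [AddCommGroup W] [Module ℂ W] (ρ : Representation ℂ G V) (σ : Representation ℂ G W) where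
  num : V → W
  den : V → ℂ
  num_isMorphism : IsMorphism num
  den_mem : den ∈ polyFun V
  den_ne_zero : den ≠ 0
  equivariant : ∀ g v, den v ≠ 0 → den (ρ g v) ≠ 0 →
    (den (ρ g v))⁻¹ • num (ρ g v) = σ g ((den v)⁻¹ • num v)

/-- `G` acts faithfully on the subset `S` of the `G`-module `σ`: no element other than `1` fixes
every point of `S`. -/
def ActsFaithfullyOn {G W : Type*} [Group G] [AddCommGroup W] [Module ℂ W]
    (σ : Representation ℂ G W) (S : Set W) : Prop :=
  ∀ g : G, (∀ w ∈ S, σ g w = w) → g = 1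

namespace Covariant

variable {G V W : Type*} [Group G] [AddCommGroup V] [Module ℂ V] [AddCommGroup W] [Module ℂ W]
  {ρ : Representation ℂ G V} {σ : Representation ℂ G W}

/-- The dimension of the closure of the image. -/
noncomputable def dim (φ : Covariant ρ σ) : ℕ := zariskiDim (Set.range φ.toFun)

/-- `G` acts faithfully on the image. -/
def IsFaithful (φ : Covariant ρ σ) : Prop := ActsFaithfullyOn σ (Set.range φ.toFun)

end Covariant

namespace RationalCovariant

variable {G V W : Type*} [Group G] [AddCommGroup V] [Module ℂ V] [AddCommGroup W] [Module ℂ W]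
  {ρ : Representation ℂ G V} {σ : Representation ℂ G W}

/-- The dense open set on which the presentation `num / den` is defined. -/
def domain (φ : RationalCovariant ρ σ) : Set V := {v | φ.den v ≠ 0}

/-- The value of the rational map at a point of `domain`. -/
noncomputable def toFun (φ : RationalCovariant ρ σ) (v : V) : W := (φ.den v)⁻¹ • φ.num v

/-- The dimension of the closure of the image. -/
noncomputable def dim (φ : RationalCovariant ρ σ) : ℕ := zariskiDim (φ.toFun '' φ.domain)

/-- `G` acts faithfully on the image. -/
def IsFaithful (φ : RationalCovariant ρ σ) : Prop := ActsFaithfullyOn σ (φ.toFun '' φ.domain)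

end RationalCovariant

/-- The covariant dimension of `G`: the minimum of the dimensions of all its faithful regular
covariants between finite dimensional `G`-modules (for a finite group there are such covariants,
e.g. the identity of a faithful module). -/
noncomputable def covdim (G : Type*) [Group G] : ℕ :=
  sInf {d : ℕ | ∃ (V W : Type) (_ : AddCommGroup V) (_ : Module ℂ V) (_ : AddCommGroup W)
    (_ : Module ℂ W) (_ : FiniteDimensional ℂ V) (_ : FiniteDimensional ℂ W)
    (ρ : Representation ℂ G V) (σ : Representation ℂ G W) (φ : Covariant ρ σ),
    φ.IsFaithful ∧ φ.dim = d}

/-- The essential dimension of `G`: the minimum of the dimensions of all its faithful rational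
covariants between finite dimensional `G`-modules (for a finite group there are such covariants,
e.g. the identity of a faithful module). -/
noncomputable def edim (G : Type*) [Group G] : ℕ :=
  sInf {d : ℕ | ∃ (V W : Type) (_ : AddCommGroup V) (_ : Module ℂ V) (_ : AddCommGroup W)
    (_ : Module ℂ W) (_ : FiniteDimensional ℂ V) (_ : FiniteDimensional ℂ W)
    (ρ : Representation ℂ G V) (σ : Representation ℂ G W) (φ : RationalCovariant ρ σ),
    φ.IsFaithful ∧ φ.dim = d}

/-! ### Direct sums and multihomogeneous maps -/

/-- The direct sum `⨁ᵢ Vᵢ` of finitely many `G`-modules, realized as the product with the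
componentwise action. -/
def sumRep {G ι : Type*} [Group G] {V : ι → Type*} [∀ i, AddCommGroup (V i)]
    [∀ i, Module ℂ (V i)] (ρ : ∀ i, Representation ℂ G (V i)) :
    Representation ℂ G (∀ i, V i) where
  toFun g := LinearMap.pi fun i => ρ i g ∘ₗ LinearMap.proj i
  map_one' := by ext; simp
  map_mul' g h := by ext; simp

/-- The map `f = (f₁, …, fₘ)` from the subset `D` of `⨁ᵢ Vᵢ` to `⨁ⱼ Wⱼ` has no zero component and
is multihomogeneous of degree `A`, i.e. `fⱼ(v₁, …, s vᵢ, …, vₙ) = s ^ Aⱼᵢ fⱼ(v₁, …, vₙ)` for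
all `i`, `j` and all nonzero scalars `s`, wherever both sides are defined. -/
def IsMultihomogeneousOn {ι κ : Type*} [DecidableEq ι] {V : ι → Type*} {W : κ → Type*}
    [∀ i, AddCommGroup (V i)] [∀ i, Module ℂ (V i)]
    [∀ j, AddCommGroup (W j)] [∀ j, Module ℂ (W j)]
    (D : Set (∀ i, V i)) (f : (∀ i, V i) → ∀ j, W j) (A : Matrix κ ι ℤ) : Prop :=
  (∀ j, ∃ v ∈ D, f v j ≠ 0) ∧
  ∀ j i, ∀ s : ℂ, s ≠ 0 → ∀ v ∈ D, Function.update v i (s • v i) ∈ D →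
    f (Function.update v i (s • v i)) j = s ^ A j i • f v j

/-- The rank of an integer matrix, i.e. its rank over the rational numbers. -/
noncomputable def intRank {m n : ℕ} (A : Matrix (Fin m) (Fin n) ℤ) : ℕ :=
  (A.map (Int.cast : ℤ → ℚ)).rank

end CovDim

/-! A covariant is treated as a `W`-valued rational function `Φ` on `V`, that is, a linear map from
the dual of `W` to ℂ(V). Its dimension is the transcendence degree over ℂ of the field K generated
by its coordinates (`dim_eq_trdeg`), and equivariance and faithfulness can be read off from `Φ`.

The torus (ℂˣ)ⁿ rescaling the summands acts on ℂ(V) and commutes with `G`; multihomogeneity says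
that the coordinates of φⱼ have weight Aⱼ. Let M be the subfield of weight zero in K. An element of
`G` fixing M fixes all quotients of coordinates of one φⱼ, so it acts on each irreducible Wⱼ by a
scalar. It is then central, hence trivial (`eq_one_of_fixes_weightZero`). Since `G` is faithful on
M, Dedekind's independence of characters gives a nonzero `G`-invariant hⱼ in K of weight Aⱼ
(`exists_invariant_of_weight`). The functions φⱼ / hⱼ form a faithful equivariant Ψ with coordinates
in M.

Coordinates of φ with linearly independent weights are algebraically independent over the functions
of weight zero (`algebraicIndependent_of_hasWeight`), so passing from φ to Ψ lowers the
transcendence degree by at least rank A. This bounds edim. Multiplying Ψ by an invariant common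
denominator makes it regular and costs at most one dimension, which bounds covdim. For minimal φ the
bounds give rank A ≤ 1 (regular) or rank A = 0 (rational); a regular φ with A = 0 is constant, which
is not faithful for non-trivial `G`. -/

/-! ### Krull dimension as transcendence degree -/

theorem ringKrullDim_eq_of_isIntegral {R S : Type*} [CommRing R] [CommRing S] [Algebra R S]
    [Algebra.IsIntegral R S] (hinj : Function.Injective (algebraMap R S)) :
    ringKrullDim R = ringKrullDim S := by
  have : FaithfulSMul R S := (faithfulSMul_iff_algebraMap_injective R S).mpr hinj
  refine le_antisymm ?_ ?_
  -- Lying over provides a prime above the bottom of a chain, and going up lifts the rest of it.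
  · refine iSup_le fun l => ?_
    obtain ⟨Q, -, hQ, hQl⟩ := Ideal.exists_ideal_over_prime_of_isIntegral l.head.asIdeal
      (⊥ : Ideal S)
      (by rw [Ideal.comap_bot_of_injective _ hinj]; exact bot_le)
    have : Q.LiesOver l.head.asIdeal := ⟨hQl.symm⟩
    obtain ⟨l', hl', -⟩ := Ideal.exists_ltSeries_of_hasGoingUp (S := S) l Q
    rw [← hl']
    exact le_iSup (fun p : LTSeries (PrimeSpectrum S) => (p.length : WithBot ℕ∞)) l'
  -- Incomparability: in an integral extension contraction preserves strict inclusions of primes.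
  · refine Order.krullDim_le_of_strictMono (PrimeSpectrum.comap (algebraMap R S)) ?_
    intro I J hIJ
    obtain ⟨hle, x, hxJ, hxI⟩ := SetLike.lt_iff_le_and_exists.mp
      (show I.asIdeal < J.asIdeal from hIJ)
    exact Ideal.comap_lt_comap_of_integral_mem_sdiff hle ⟨hxJ, hxI⟩
      (Algebra.IsIntegral.isIntegral x)

/-- Noether normalization: `A` is integral over a polynomial ring in `s` variables, and both
invariants equal `s`. -/
theorem ringKrullDim_eq_trdeg (k A : Type*) [Field k] [CommRing A] [IsDomain A] [Algebra k A]
    [Algebra.FiniteType k A] :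
    ringKrullDim A = ((Algebra.trdeg k A).toNat : WithBot ℕ∞) := by
  obtain ⟨s, g, hinj, hint⟩ := exists_integral_inj_algHom_of_fg k A
  algebraize [g.toRingHom]
  have hi : Function.Injective (algebraMap (MvPolynomial (Fin s) k) A) := hinj
  have hf : FaithfulSMul (MvPolynomial (Fin s) k) A :=
    (faithfulSMul_iff_algebraMap_injective _ _).mpr hi
  have hI : Algebra.IsIntegral (MvPolynomial (Fin s) k) A := ⟨hint⟩
  have htower : IsScalarTower k (MvPolynomial (Fin s) k) A :=
    IsScalarTower.of_algebraMap_eq fun x => (g.commutes x).symm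
  have h1 := lift_trdeg_add_eq k (MvPolynomial (Fin s) k) A
  rw [trdeg_eq_zero (R := MvPolynomial (Fin s) k) (A := A),
    MvPolynomial.trdeg_of_isDomain] at h1
  have h2 := congrArg Cardinal.toNat h1
  simp at h2
  rw [← ringKrullDim_eq_of_isIntegral hi, MvPolynomial.ringKrullDim_of_isNoetherianRing, ← h2]
  simp

/-! ### Transcendence degrees of intermediate fields -/

section TranscendenceDegree

variable {k L : Type*} [Field k] [Field L] [Algebra k L]

theorem trdeg_add_trdeg_intermediateField (E : IntermediateField k L)
    (F : IntermediateField E L) :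
    Algebra.trdeg k E + Algebra.trdeg E F = Algebra.trdeg k F := by
  have : FaithfulSMul E F :=
    (faithfulSMul_iff_algebraMap_injective _ _).mpr (algebraMap E F).injective
  exact trdeg_add_eq k E (A := F)

theorem trdeg_intermediateField_adjoin (s : Set L) :
    Algebra.trdeg k (IntermediateField.adjoin k s) = Algebra.trdeg k (Algebra.adjoin k s) := by
  let i : Algebra.adjoin k s →ₐ[k] IntermediateField.adjoin k s :=
    Subalgebra.inclusion (IntermediateField.algebra_adjoin_le_adjoin k s)
  have hi : Function.Injective i :=
    Subalgebra.inclusion_injective (IntermediateField.algebra_adjoin_le_adjoin k s)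
  algebraize [i.toRingHom]
  have : FaithfulSMul (Algebra.adjoin k s) (IntermediateField.adjoin k s) :=
    (faithfulSMul_iff_algebraMap_injective _ _).mpr hi
  have : IsScalarTower k (Algebra.adjoin k s) (IntermediateField.adjoin k s) :=
    IsScalarTower.of_algebraMap_eq fun x => (i.commutes x).symm
  have halg : Algebra.IsAlgebraic (Algebra.adjoin k s) (IntermediateField.adjoin k s) := by
    refine ⟨fun x => ?_⟩
    obtain ⟨a, ha, b, hb, h⟩ := IntermediateField.mem_adjoin_iff_div.mp x.2
    have hx : x = i ⟨a, ha⟩ / i ⟨b, hb⟩ := Subtype.ext h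
    rw [hx, div_eq_mul_inv]
    exact (isAlgebraic_algebraMap (A := IntermediateField.adjoin k s)
      (⟨a, ha⟩ : Algebra.adjoin k s)).mul
      (isAlgebraic_algebraMap (A := IntermediateField.adjoin k s)
      (⟨b, hb⟩ : Algebra.adjoin k s)).inv
  have h := trdeg_add_eq k (Algebra.adjoin k s) (A := IntermediateField.adjoin k s)
  rw [trdeg_eq_zero (R := Algebra.adjoin k s), add_zero] at h
  exact h.symm

theorem trdeg_intermediateField_lt_aleph0 (h : Algebra.trdeg k L < Cardinal.aleph0)
    (E : IntermediateField k L) : Algebra.trdeg k E < Cardinal.aleph0 :=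
  (trdeg_le_of_injective E.val E.val.injective).trans_lt h

/-- `Cardinal.toNat` sends infinite cardinals to `0`, whence the finiteness hypothesis here and
below. -/
theorem trdeg_toNat_mono (h : Algebra.trdeg k L < Cardinal.aleph0) {E F : IntermediateField k L}
    (hEF : E ≤ F) : (Algebra.trdeg k E).toNat ≤ (Algebra.trdeg k F).toNat :=
  Cardinal.toNat_le_toNat (trdeg_le_of_injective (IntermediateField.inclusion hEF)
    (IntermediateField.inclusion hEF).injective) (trdeg_intermediateField_lt_aleph0 h F)

/-- This is the price of adjoining the denominator when a rational covariant is made regular. -/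
theorem trdeg_toNat_adjoin_singleton_le (h : Algebra.trdeg k L < Cardinal.aleph0)
    (E : IntermediateField k L) (x : L) :
    (Algebra.trdeg k (E ⊔ IntermediateField.adjoin k {x} : IntermediateField k L)).toNat ≤
      (Algebra.trdeg k E).toNat + 1 := by
  have h1 : Algebra.trdeg E (IntermediateField.adjoin E {x}) ≤ 1 := by
    rw [trdeg_intermediateField_adjoin]
    have : Algebra.IsAlgebraic
        (Algebra.adjoin E {(⟨x, Algebra.subset_adjoin rfl⟩ : Algebra.adjoin E {x})})
        (Algebra.adjoin E {x}) := by
      refine ⟨fun y => ?_⟩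
      have hy : y ∈ Algebra.adjoin E
          {(⟨x, Algebra.subset_adjoin rfl⟩ : Algebra.adjoin E {x})} := by
        have h2 : (Algebra.adjoin E
          {(⟨x, Algebra.subset_adjoin rfl⟩ : Algebra.adjoin E {x})}).map
            (Algebra.adjoin E {x}).val = Algebra.adjoin E {x} := by
          rw [AlgHom.map_adjoin]; simp
        obtain ⟨z, hz, hzy⟩ := (SetLike.ext_iff.mp h2 (y : L)).mpr y.2
        rwa [← show z = y from Subtype.ext hzy]
      exact isAlgebraic_algebraMap (⟨y, hy⟩ : Algebra.adjoin E
          {(⟨x, Algebra.subset_adjoin rfl⟩ : Algebra.adjoin E {x})})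
    simpa using Algebra.IsAlgebraic.trdeg_le_cardinalMk (R := E) (A := Algebra.adjoin E {x})
      {(⟨x, Algebra.subset_adjoin rfl⟩ : Algebra.adjoin E {x})}
  have h2 := trdeg_add_trdeg_intermediateField (k := k) E (IntermediateField.adjoin E {x})
  have h3 : Algebra.trdeg k (IntermediateField.adjoin E {x}) =
      Algebra.trdeg k ((IntermediateField.adjoin E {x}).restrictScalars k) := rfl
  have h4 : E ⊔ IntermediateField.adjoin k {x} =
      (IntermediateField.adjoin E {x}).restrictScalars k :=
    (IntermediateField.restrictScalars_adjoin_eq_sup k E {x}).symm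
  have hE := trdeg_intermediateField_lt_aleph0 h E
  rw [h4, ← h3, ← h2, Cardinal.toNat_add hE (h1.trans_lt Cardinal.one_lt_aleph0)]
  have h5 := Cardinal.toNat_le_toNat h1 Cardinal.one_lt_aleph0
  simp at h5
  lia

theorem trdeg_toNat_add_card_le (h : Algebra.trdeg k L < Cardinal.aleph0)
    {E F : IntermediateField k L} (hEF : E ≤ F) {ι : Type*} [Finite ι] {x : ι → L}
    (hx : AlgebraicIndependent E x) (hxF : ∀ i, x i ∈ F) :
    (Algebra.trdeg k E).toNat + Nat.card ι ≤ (Algebra.trdeg k F).toNat := by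
  let F' : IntermediateField E L := IntermediateField.extendScalars hEF
  let y : ι → F' := fun i => ⟨x i, hxF i⟩
  have hy : AlgebraicIndependent E y := AlgebraicIndependent.of_comp (f := F'.val) hx
  have h1 := hy.lift_cardinalMk_le_trdeg
  have h2 : Algebra.trdeg k E + Algebra.trdeg E F' = Algebra.trdeg k F :=
    trdeg_add_trdeg_intermediateField E F'
  have hF := trdeg_intermediateField_lt_aleph0 h F
  have hF' : Algebra.trdeg E F' < Cardinal.aleph0 := by
    rw [← h2] at hF
    exact (self_le_add_left _ _).trans_lt hF
  rw [← h2, Cardinal.toNat_add (trdeg_intermediateField_lt_aleph0 h E) hF']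
  have h3 := Cardinal.toNat_le_toNat h1 (by simpa using hF')
  simp at h3
  simpa [Nat.card] using h3

end TranscendenceDegree

namespace CovDim

/-! ### The algebra of polynomial functions -/

section PolyFun

variable {V V' W : Type*} [AddCommGroup V] [Module ℂ V] [AddCommGroup V'] [Module ℂ V']
  [AddCommGroup W] [Module ℂ W]

theorem dual_mem_polyFun (l : Module.Dual ℂ V) : (l : V → ℂ) ∈ polyFun V :=
  Algebra.subset_adjoin ⟨l, rfl⟩

theorem polyFun_comp_linearMap {f : V' → ℂ} (hf : f ∈ polyFun V') (e : V →ₗ[ℂ] V') :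
    (fun v => f (e v)) ∈ polyFun V := by
  induction hf using Algebra.adjoin_induction with
  | mem x hx => obtain ⟨l, rfl⟩ := hx; exact dual_mem_polyFun (l ∘ₗ e)
  | algebraMap r => exact (polyFun V).algebraMap_mem r
  | add f g _ _ hf hg => exact (polyFun V).add_mem hf hg
  | mul f g _ _ hf hg => exact (polyFun V).mul_mem hf hg

theorem exists_polynomial_eval_line {f : V → ℂ} (hf : f ∈ polyFun V) (v u : V) :
    ∃ p : Polynomial ℂ, ∀ t : ℂ, f (v + t • u) = p.eval t := by
  induction hf using Algebra.adjoin_induction with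
  | mem x hx =>
    obtain ⟨l, rfl⟩ := hx
    exact ⟨Polynomial.C (l v) + Polynomial.X * Polynomial.C (l u), fun t => by simp; ring⟩
  | algebraMap r => exact ⟨Polynomial.C r, fun t => by simp⟩
  | add f g _ _ hf hg =>
    obtain ⟨p, hp⟩ := hf
    obtain ⟨q, hq⟩ := hg
    exact ⟨p + q, fun t => by simp [hp, hq]⟩
  | mul f g _ _ hf hg =>
    obtain ⟨p, hp⟩ := hf
    obtain ⟨q, hq⟩ := hg
    exact ⟨p * q, fun t => by simp [hp, hq]⟩

/-- If `f v ≠ 0` and `g w ≠ 0`, restriction to the line through `v` and `w` yields two nonzero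
polynomials in one variable with product zero. -/
theorem polyFun_eq_zero_or_eq_zero {f g : V → ℂ} (hf : f ∈ polyFun V) (hg : g ∈ polyFun V)
    (h : ∀ v, f v * g v = 0) : f = 0 ∨ g = 0 := by
  by_contra! hne
  obtain ⟨v, hv⟩ := Function.ne_iff.mp hne.1
  obtain ⟨w, hw⟩ := Function.ne_iff.mp hne.2
  obtain ⟨p, hp⟩ := exists_polynomial_eval_line hf v (w - v)
  obtain ⟨q, hq⟩ := exists_polynomial_eval_line hg v (w - v)
  have hpq : p * q = 0 := Polynomial.funext fun t => by simp [← hp, ← hq, h]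
  rcases mul_eq_zero.mp hpq with h0 | h0
  · exact hv (by simpa [h0] using hp 0)
  · exact hw (by simpa [h0] using hq 1)

instance : IsDomain (polyFun V) :=
  have : NoZeroDivisors (polyFun V) := ⟨fun {f g} h => by
    rcases polyFun_eq_zero_or_eq_zero f.2 g.2 (fun v => congrFun (congrArg Subtype.val h) v)
      with h | h
    · exact Or.inl (Subtype.ext h)
    · exact Or.inr (Subtype.ext h)⟩
  NoZeroDivisors.to_isDomain _

/-- The presentation of the algebra of polynomial functions attached to a basis. -/
noncomputable def polyPresentation {ι : Type*} (b : Module.Basis ι ℂ W) :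
    MvPolynomial ι ℂ →ₐ[ℂ] polyFun W :=
  MvPolynomial.aeval fun i => ⟨b.coord i, dual_mem_polyFun (b.coord i)⟩

theorem polyPresentation_surjective {ι : Type*} [Fintype ι] (b : Module.Basis ι ℂ W) :
    Function.Surjective (polyPresentation b) := by
  rintro ⟨f, hf⟩
  have h : polyFun W ≤ ((polyFun W).val.comp (polyPresentation b)).range := by
    refine Algebra.adjoin_le ?_
    rintro _ ⟨l, rfl⟩
    refine ⟨∑ i, MvPolynomial.C (l (b i)) * MvPolynomial.X i, ?_⟩
    funext w
    have h := congrArg l (b.sum_repr w)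
    rw [map_sum] at h
    refine Eq.trans ?_ h
    simp [polyPresentation, Finset.sum_apply, mul_comm]
  obtain ⟨p, hp⟩ := h hf
  exact ⟨p, Subtype.ext hp⟩

theorem polyPresentation_apply {ι : Type*} (b : Module.Basis ι ℂ W) (p : MvPolynomial ι ℂ)
    (w : W) : (polyPresentation b p : W → ℂ) w = MvPolynomial.eval (fun i => b.repr w i) p := by
  let ev : polyFun W →ₐ[ℂ] ℂ := (Pi.evalAlgHom ℂ (fun _ : W => ℂ) w).comp (polyFun W).val
  have h : ev.comp (polyPresentation b) = MvPolynomial.aeval (fun i => b.repr w i) := by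
    ext i
    simp [ev, polyPresentation]
  exact DFunLike.congr_fun h p

instance [FiniteDimensional ℂ W] : Algebra.FiniteType ℂ (polyFun W) :=
  Algebra.FiniteType.of_surjective (polyPresentation (Module.finBasis ℂ W))
    (polyPresentation_surjective _)

theorem mem_idealOf_zariskiClosure {S : Set W} {p : polyFun W} :
    p ∈ idealOf (zariskiClosure S) ↔ ∀ w ∈ S, (p : W → ℂ) w = 0 :=
  ⟨fun h w hw => h w fun _ hq => hq w hw, fun h _ hw => hw p h⟩

/-- Composition with a linear automorphism. -/
noncomputable def polyAct : (Module.End ℂ V)ˣ →* (polyFun V ≃ₐ[ℂ] polyFun V) where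
  -- Functions are pulled back along the inverse, so that the result is a left action.
  toFun u :=
    { toFun := fun f => ⟨fun v => (f : V → ℂ) (u⁻¹.val v), polyFun_comp_linearMap f.2 u⁻¹.val⟩
      invFun := fun f => ⟨fun v => (f : V → ℂ) (u.val v), polyFun_comp_linearMap f.2 u.val⟩
      left_inv := fun f => Subtype.ext <| funext fun v => congrArg (f : V → ℂ)
        (DFunLike.congr_fun u.inv_mul v)
      right_inv := fun f => Subtype.ext <| funext fun v => congrArg (f : V → ℂ)
        (DFunLike.congr_fun u.mul_inv v)
      map_mul' := fun _ _ => rfl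
      map_add' := fun _ _ => rfl
      commutes' := fun _ => rfl }
  map_one' := by ext; simp
  map_mul' u u' := by ext; simp only [mul_inv_rev]; rfl

end PolyFun

/-! ### The field of rational functions -/

section RatFun

theorem isScalarTower_fractionRing (A B : Type*) [CommRing A] [CommRing B] [Algebra A B] :
    IsScalarTower A B (FractionRing B) := inferInstance

/-- The field of rational functions on `V`. -/
def RatFun (V : Type*) [AddCommGroup V] [Module ℂ V] := FractionRing (polyFun V)

variable {V W : Type*} [AddCommGroup V] [Module ℂ V] [AddCommGroup W] [Module ℂ W]

noncomputable instance : Field (RatFun V) := inferInstanceAs (Field (FractionRing (polyFun V)))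

noncomputable instance : Algebra (polyFun V) (RatFun V) :=
  inferInstanceAs (Algebra (polyFun V) (FractionRing (polyFun V)))

noncomputable instance : Algebra ℂ (RatFun V) :=
  inferInstanceAs (Algebra ℂ (FractionRing (polyFun V)))

instance : IsScalarTower ℂ (polyFun V) (RatFun V) :=
  isScalarTower_fractionRing ℂ (polyFun V)

instance : IsFractionRing (polyFun V) (RatFun V) :=
  Localization.isLocalization (M := nonZeroDivisors (polyFun V))

theorem algebraMap_ratFun_injective : Function.Injective (algebraMap (polyFun V) (RatFun V)) :=
  IsFractionRing.injective _ _

instance : FaithfulSMul (polyFun V) (RatFun V) :=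
  (faithfulSMul_iff_algebraMap_injective _ _).mpr algebraMap_ratFun_injective

instance : FaithfulSMul ℂ (polyFun V) :=
  (faithfulSMul_iff_algebraMap_injective _ _).mpr (algebraMap ℂ (polyFun V)).injective

/-- The rational function given by a polynomial function. -/
noncomputable def toRat (f : V → ℂ) (hf : f ∈ polyFun V) : RatFun V :=
  algebraMap (polyFun V) (RatFun V) ⟨f, hf⟩

theorem toRat_eq_zero {f : V → ℂ} {hf : f ∈ polyFun V} : toRat f hf = 0 ↔ f = 0 := by
  rw [toRat, map_eq_zero_iff _ algebraMap_ratFun_injective]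
  exact Subtype.ext_iff

theorem toRat_inj {f g : V → ℂ} {hf : f ∈ polyFun V} {hg : g ∈ polyFun V} :
    toRat f hf = toRat g hg ↔ f = g := by
  rw [toRat, toRat, algebraMap_ratFun_injective.eq_iff]
  exact Subtype.ext_iff

theorem trdeg_ratFun_lt_aleph0 [FiniteDimensional ℂ V] :
    Algebra.trdeg ℂ (RatFun V) < Cardinal.aleph0 := by
  have h := trdeg_add_eq ℂ (polyFun V) (A := RatFun V)
  have : Algebra.IsAlgebraic (polyFun V) (RatFun V) :=
    (IsFractionRing.comap_isAlgebraic_iff (A := polyFun V) (C := RatFun V) (K := RatFun V)).mpr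
      inferInstance
  rw [trdeg_eq_zero (R := polyFun V), add_zero] at h
  rw [← h]
  exact trdeg_lt_aleph0_of_finiteType

/-- The action of the linear automorphisms of `V` on the rational functions on `V`. -/
noncomputable def ratAct : (Module.End ℂ V)ˣ →* (RatFun V ≃ₐ[ℂ] RatFun V) :=
  (IsFractionRing.fieldEquivOfAlgEquivHom ℂ (RatFun V)).comp polyAct

theorem ratAct_toRat (u : (Module.End ℂ V)ˣ) (f : V → ℂ) (hf : f ∈ polyFun V) :
    ratAct u (toRat f hf) =
      toRat (fun v => f (u⁻¹.val v)) (polyFun_comp_linearMap hf u⁻¹.val) := by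
  rw [ratAct, MonoidHom.comp_apply, toRat, IsFractionRing.fieldEquivOfAlgEquivHom_apply,
    IsFractionRing.fieldEquivOfAlgEquiv_algebraMap]
  rfl

end RatFun

section RatFunIdentities

variable {V : Type*} [AddCommGroup V] [Module ℂ V]

theorem toRat_mul {f g : V → ℂ} (hf : f ∈ polyFun V) (hg : g ∈ polyFun V) :
    toRat f hf * toRat g hg = toRat (f * g) ((polyFun V).mul_mem hf hg) :=
  (map_mul (algebraMap (polyFun V) (RatFun V)) _ _).symm

theorem toRat_add {f g : V → ℂ} (hf : f ∈ polyFun V) (hg : g ∈ polyFun V) :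
    toRat f hf + toRat g hg = toRat (f + g) ((polyFun V).add_mem hf hg) :=
  (map_add (algebraMap (polyFun V) (RatFun V)) _ _).symm

theorem toRat_smul (c : ℂ) {f : V → ℂ} (hf : f ∈ polyFun V) :
    c • toRat f hf = toRat (c • f) ((polyFun V).smul_mem hf c) := by
  rw [Algebra.smul_def, IsScalarTower.algebraMap_apply ℂ (polyFun V) (RatFun V), toRat, toRat,
    ← map_mul, ← Algebra.smul_def]
  rfl

/-- This links identities in the function field to pointwise ones. For the converse, `(a * d - c *
b) * (b * d)` vanishes everywhere: off the zeros of `b * d` by hypothesis, on them trivially. The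
first factor must then be zero. -/
theorem toRat_div_eq_iff {a b c d : V → ℂ} (ha : a ∈ polyFun V) (hb : b ∈ polyFun V)
    (hc : c ∈ polyFun V) (hd : d ∈ polyFun V) (hb0 : b ≠ 0) (hd0 : d ≠ 0) :
    toRat a ha / toRat b hb = toRat c hc / toRat d hd ↔
      ∀ v, b v ≠ 0 → d v ≠ 0 → (b v)⁻¹ * a v = (d v)⁻¹ * c v := by
  rw [div_eq_div_iff (mt toRat_eq_zero.mp hb0) (mt toRat_eq_zero.mp hd0), toRat_mul, toRat_mul,
    toRat_inj]
  constructor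
  · intro h v hbv hdv
    have h1 : a v * d v = c v * b v := congrFun h v
    field_simp
    linear_combination h1
  · intro h
    have hm : a * d - c * b ∈ polyFun V :=
      (polyFun V).sub_mem ((polyFun V).mul_mem ha hd) ((polyFun V).mul_mem hc hb)
    have h1 := polyFun_eq_zero_or_eq_zero hm ((polyFun V).mul_mem hb hd) (fun v => by
      by_cases hbv : b v = 0
      · simp [hbv]
      by_cases hdv : d v = 0
      · simp [hdv]
      have h2 := h v hbv hdv
      field_simp at h2
      simp only [Pi.sub_apply, Pi.mul_apply, mul_eq_zero]
      left
      linear_combination h2)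
    rcases h1 with h1 | h1
    · exact sub_eq_zero.mp h1
    · rcases polyFun_eq_zero_or_eq_zero hb hd (fun v => congrFun h1 v) with h2 | h2
      · exact absurd h2 hb0
      · exact absurd h2 hd0

end RatFunIdentities

/-! ### Covariants as vector-valued rational functions -/

section Generic

variable {G V W : Type*} [Group G] [AddCommGroup V] [Module ℂ V] [AddCommGroup W] [Module ℂ W]
  {ρ : Representation ℂ G V} {σ : Representation ℂ G W}

/-- The action of `G` on the rational functions on a `G`-module. -/
noncomputable def ratRep (ρ : Representation ℂ G V) : G →* (RatFun V ≃ₐ[ℂ] RatFun V) :=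
  ratAct.comp (MonoidHom.toHomUnits ρ)

theorem ratRep_toRat (g : G) (f : V → ℂ) (hf : f ∈ polyFun V) :
    ratRep ρ g (toRat f hf) =
      toRat (fun v => f (ρ g⁻¹ v)) (polyFun_comp_linearMap hf (ρ g⁻¹)) := by
  rw [ratRep, MonoidHom.comp_apply, ratAct_toRat, toRat_inj]
  funext v
  rw [← map_inv]
  rfl

/-- The `W`-valued rational function `Φ` on `V`, given by its linear coordinates, is
equivariant. -/
def IsEquivariant (ρ : Representation ℂ G V) (σ : Representation ℂ G W)
    (Φ : Module.Dual ℂ W →ₗ[ℂ] RatFun V) : Prop :=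
  ∀ g l, ratRep ρ g (Φ l) = Φ (l ∘ₗ σ g⁻¹)

/-- No element of `G` other than `1` fixes the `W`-valued rational function `Φ`. -/
def IsGenericallyFaithful (σ : Representation ℂ G W) (Φ : Module.Dual ℂ W →ₗ[ℂ] RatFun V) : Prop :=
  ∀ g, (∀ l, Φ (l ∘ₗ σ g) = Φ l) → g = 1

/-- The field generated by the coordinates of a `W`-valued rational function. -/
noncomputable def coordField (Φ : Module.Dual ℂ W →ₗ[ℂ] RatFun V) :
    IntermediateField ℂ (RatFun V) :=
  IntermediateField.adjoin ℂ (Set.range Φ)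

theorem mem_coordField (Φ : Module.Dual ℂ W →ₗ[ℂ] RatFun V) (l : Module.Dual ℂ W) :
    Φ l ∈ coordField Φ :=
  IntermediateField.subset_adjoin _ _ ⟨l, rfl⟩

theorem mem_coordField_of_isEquivariant {Φ : Module.Dual ℂ W →ₗ[ℂ] RatFun V}
    (hΦ : IsEquivariant ρ σ Φ) (g : G) {x : RatFun V} (hx : x ∈ coordField Φ) :
    ratRep ρ g x ∈ coordField Φ := by
  have h : coordField Φ ≤ (coordField Φ).comap (ratRep ρ g : RatFun V →ₐ[ℂ] RatFun V) := by
    refine IntermediateField.adjoin_le_iff.mpr ?_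
    rintro _ ⟨l, rfl⟩
    change ratRep ρ g (Φ l) ∈ coordField Φ
    rw [hΦ]
    exact mem_coordField _ _
  exact h hx

namespace RationalCovariant

variable (φ : RationalCovariant ρ σ)

/-- The coordinates of a rational covariant as rational functions. -/
noncomputable def generic : Module.Dual ℂ W →ₗ[ℂ] RatFun V where
  toFun l := toRat (fun v => l (φ.num v)) (φ.num_isMorphism l) / toRat φ.den φ.den_mem
  map_add' l l' := by
    rw [← add_div, toRat_add]
    rfl
  map_smul' c l := by
    rw [RingHom.id_apply, ← smul_div_assoc, toRat_smul]
    rfl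

theorem generic_apply (l : Module.Dual ℂ W) : φ.generic l =
    toRat (fun v => l (φ.num v)) (φ.num_isMorphism l) / toRat φ.den φ.den_mem := rfl

theorem toRat_den_ne_zero : toRat φ.den φ.den_mem ≠ 0 := mt toRat_eq_zero.mp φ.den_ne_zero

theorem isEquivariant_generic : IsEquivariant ρ σ φ.generic := by
  intro g l
  have hne : (fun v => φ.den (ρ g⁻¹ v)) ≠ 0 := by
    intro h
    refine φ.den_ne_zero (funext fun v => ?_)
    have := congrFun h (ρ g v)
    simpa [← Module.End.mul_apply, ← map_mul] using this
  rw [generic_apply, generic_apply, map_div₀, ratRep_toRat, ratRep_toRat,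
    toRat_div_eq_iff _ _ _ _ hne φ.den_ne_zero]
  intro v h1 h2
  have h := congrArg l (φ.equivariant g⁻¹ v h2 h1)
  simpa using h

theorem fixes_image_iff (g : G) :
    (∀ w ∈ φ.toFun '' φ.domain, σ g w = w) ↔ ∀ l, φ.generic (l ∘ₗ σ g) = φ.generic l := by
  simp only [generic_apply, toRat_div_eq_iff _ _ _ _ φ.den_ne_zero φ.den_ne_zero]
  constructor
  · intro h l v hv _
    have h1 := congrArg l (h _ ⟨v, hv, rfl⟩)
    simpa [toFun] using h1
  · rintro h _ ⟨v, hv, rfl⟩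
    rw [← sub_eq_zero, ← Module.forall_dual_apply_eq_zero_iff ℂ]
    intro l
    have h1 := h l v hv hv
    simpa [toFun, sub_eq_zero] using h1

theorem isFaithful_iff : φ.IsFaithful ↔ IsGenericallyFaithful σ φ.generic :=
  forall_congr' fun g => by rw [fixes_image_iff]

/-- The same power of the denominator clears poles in the function field and pointwise on the
domain, so that vanishing can be compared on both sides. -/
theorem exists_clear_denominators {ι : Type*} (b : Module.Basis ι ℂ W) (p : MvPolynomial ι ℂ) :
    ∃ (k : ℕ) (f : V → ℂ) (hf : f ∈ polyFun V),
      toRat f hf = toRat φ.den φ.den_mem ^ k *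
        MvPolynomial.aeval (fun i => φ.generic (b.coord i)) p ∧
      ∀ v ∈ φ.domain, f v = φ.den v ^ k *
        MvPolynomial.eval (fun i => b.repr (φ.toFun v) i) p := by
  induction p using MvPolynomial.induction_on with
  | C a =>
    refine ⟨0, algebraMap ℂ (V → ℂ) a, (polyFun V).algebraMap_mem a, ?_, fun v _ => by simp⟩
    rw [pow_zero, one_mul, MvPolynomial.aeval_C,
      IsScalarTower.algebraMap_apply ℂ (polyFun V) (RatFun V)]
    rfl
  | add p q hp hq =>
    obtain ⟨k, f, hf, h1, h2⟩ := hp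
    obtain ⟨k', f', hf', h1', h2'⟩ := hq
    have hk := (polyFun V).pow_mem φ.den_mem k
    have hk' := (polyFun V).pow_mem φ.den_mem k'
    have hpow : ∀ n, toRat (φ.den ^ n) ((polyFun V).pow_mem φ.den_mem n) =
        toRat φ.den φ.den_mem ^ n := fun n =>
      map_pow (algebraMap (polyFun V) (RatFun V)) ⟨φ.den, φ.den_mem⟩ n
    refine ⟨k + k', φ.den ^ k' * f + φ.den ^ k * f', (polyFun V).add_mem
      ((polyFun V).mul_mem hk' hf) ((polyFun V).mul_mem hk hf'), ?_, fun v hv => ?_⟩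
    · rw [← toRat_add ((polyFun V).mul_mem hk' hf) ((polyFun V).mul_mem hk hf'),
        ← toRat_mul hk' hf, ← toRat_mul hk hf', h1, h1', hpow, hpow, map_add]
      ring
    · simp only [Pi.add_apply, Pi.mul_apply, Pi.pow_apply, h2 v hv, h2' v hv, map_add]
      ring
  | mul_X p i hp =>
    obtain ⟨k, f, hf, h1, h2⟩ := hp
    refine ⟨k + 1, f * (fun v => b.coord i (φ.num v)),
      (polyFun V).mul_mem hf (φ.num_isMorphism _), ?_, fun v hv => ?_⟩
    · rw [← toRat_mul hf (φ.num_isMorphism _), h1, map_mul, MvPolynomial.aeval_X, generic_apply]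
      have := φ.toRat_den_ne_zero
      field_simp
      ring
    · have hv' : φ.den v ≠ 0 := hv
      simp only [Pi.mul_apply, h2 v hv, map_mul, MvPolynomial.eval_X, toFun, map_smul,
        Finsupp.smul_apply, smul_eq_mul, Module.Basis.coord_apply]
      field_simp
      ring

theorem aeval_generic_eq_zero_iff {ι : Type*} (b : Module.Basis ι ℂ W) (p : MvPolynomial ι ℂ) :
    MvPolynomial.aeval (fun i => φ.generic (b.coord i)) p = 0 ↔
      polyPresentation b p ∈ idealOf (zariskiClosure (φ.toFun '' φ.domain)) := by
  rw [mem_idealOf_zariskiClosure]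
  simp only [polyPresentation_apply]
  obtain ⟨k, f, hf, h1, h2⟩ := φ.exists_clear_denominators b p
  have h3 : MvPolynomial.aeval (fun i => φ.generic (b.coord i)) p = 0 ↔ f = 0 := by
    rw [← toRat_eq_zero (hf := hf), h1, mul_eq_zero,
      or_iff_right (pow_ne_zero k φ.toRat_den_ne_zero)]
  rw [h3]
  constructor
  · rintro rfl _ ⟨v, hv, rfl⟩
    have h4 := h2 v hv
    simpa [show φ.den v ≠ 0 from hv] using h4
  · intro h
    refine (polyFun_eq_zero_or_eq_zero hf φ.den_mem fun v => ?_).resolve_right φ.den_ne_zero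
    by_cases hv : φ.den v = 0
    · rw [hv, mul_zero]
    · rw [h2 v hv, h _ ⟨v, hv, rfl⟩, mul_zero, zero_mul]

/-- The polynomials vanishing on the image are exactly the algebraic relations between the
coordinates of `φ`. The coordinate ring of the closure is therefore the subalgebra of the function
field which these coordinates generate. -/
theorem dim_eq_trdeg [FiniteDimensional ℂ V] [FiniteDimensional ℂ W] :
    φ.dim = (Algebra.trdeg ℂ (coordField φ.generic)).toNat := by
  let b := Module.finBasis ℂ W
  let I := idealOf (zariskiClosure (φ.toFun '' φ.domain))
  let ev : MvPolynomial (Fin (Module.finrank ℂ W)) ℂ →ₐ[ℂ] RatFun V :=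
    MvPolynomial.aeval fun i => φ.generic (b.coord i)
  let q : MvPolynomial (Fin (Module.finrank ℂ W)) ℂ →+* polyFun W ⧸ I :=
    (Ideal.Quotient.mk I).comp (polyPresentation b : _ →+* polyFun W)
  have hq : Function.Surjective q :=
    Ideal.Quotient.mk_surjective.comp (polyPresentation_surjective b)
  have hker : RingHom.ker q = RingHom.ker ev.toRingHom := by
    ext p
    rw [RingHom.mem_ker, RingHom.mem_ker]
    exact Ideal.Quotient.eq_zero_iff_mem.trans (φ.aeval_generic_eq_zero_iff b p).symm
  have e1 : ringKrullDim (polyFun W ⧸ I) = ringKrullDim ev.toRingHom.range :=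
    ringKrullDim_eq_of_ringEquiv <| (RingHom.quotientKerEquivOfSurjective hq).symm.trans <|
      (Ideal.quotEquivOfEq hker).trans (RingHom.quotientKerEquivRange ev.toRingHom)
  have e2 : ev.range = Algebra.adjoin ℂ (Set.range fun i => φ.generic (b.coord i)) :=
    (Algebra.adjoin_range_eq_range_aeval ℂ _).symm
  have e3 : coordField φ.generic =
      IntermediateField.adjoin ℂ (Set.range fun i => φ.generic (b.coord i)) := by
    refine le_antisymm (IntermediateField.adjoin_le_iff.mpr ?_)
      (IntermediateField.adjoin.mono _ _ _ ?_)
    · rintro _ ⟨l, rfl⟩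
      rw [← b.sum_dual_apply_smul_coord l, map_sum]
      refine sum_mem fun i _ => ?_
      rw [map_smul]
      exact IntermediateField.smul_mem _
        (IntermediateField.subset_adjoin _ _ (Set.mem_range_self (f := fun i => _) i))
    · rintro _ ⟨i, rfl⟩
      exact ⟨_, rfl⟩
  have hne : (φ.toFun '' φ.domain).Nonempty := by
    obtain ⟨v, hv⟩ := Function.ne_iff.mp φ.den_ne_zero
    exact ⟨_, v, hv, rfl⟩
  have : Algebra.FiniteType ℂ ev.range :=
    Algebra.FiniteType.of_surjective ev.rangeRestrict ev.rangeRestrict_surjective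
  have h := ringKrullDim_eq_trdeg ℂ ev.range
  rw [dim, e3, trdeg_intermediateField_adjoin, ← e2]
  have h' := (coe_zariskiDim hne).trans (e1.trans h)
  exact_mod_cast h'

end RationalCovariant

/-- A regular covariant as a rational covariant. -/
def Covariant.toRational (φ : Covariant ρ σ) : RationalCovariant ρ σ where
  num := φ.toFun
  den := 1
  num_isMorphism := φ.isMorphism
  den_mem := (polyFun V).one_mem
  den_ne_zero := one_ne_zero
  equivariant g v _ _ := by simp [φ.equivariant]

namespace Covariant

variable (φ : Covariant ρ σ)

theorem toRational_toFun : φ.toRational.toFun = φ.toFun := by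
  funext v
  simp [toRational, RationalCovariant.toFun]

theorem toRational_domain : φ.toRational.domain = Set.univ := by
  ext v
  simp [toRational, RationalCovariant.domain]

theorem toRational_dim : φ.toRational.dim = φ.dim := by
  rw [RationalCovariant.dim, toRational_toFun, toRational_domain, Set.image_univ, dim]

theorem toRational_isFaithful : φ.toRational.IsFaithful ↔ φ.IsFaithful := by
  rw [RationalCovariant.IsFaithful, toRational_toFun, toRational_domain, Set.image_univ,
    IsFaithful]

end Covariant

end Generic

/-! ### Transport to coordinate spaces -/

section Transport

variable {G V W V' W' : Type*} [Group G] [AddCommGroup V] [Module ℂ V] [AddCommGroup W]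
  [Module ℂ W] [AddCommGroup V'] [Module ℂ V'] [AddCommGroup W'] [Module ℂ W']
  {ρ : Representation ℂ G V} {σ : Representation ℂ G W}

/-- Precomposition with a linear isomorphism. -/
noncomputable def polyFunCongr (e : W ≃ₗ[ℂ] W') : polyFun W' ≃+* polyFun W where
  toFun f := ⟨fun w => (f : W' → ℂ) (e w), polyFun_comp_linearMap f.2 e.toLinearMap⟩
  invFun f := ⟨fun w => (f : W → ℂ) (e.symm w), polyFun_comp_linearMap f.2 e.symm.toLinearMap⟩
  left_inv f := Subtype.ext <| funext fun w => congrArg (f : W' → ℂ) (e.apply_symm_apply w)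
  right_inv f := Subtype.ext <| funext fun w => congrArg (f : W → ℂ) (e.symm_apply_apply w)
  map_mul' _ _ := rfl
  map_add' _ _ := rfl

theorem zariskiDim_image (e : W ≃ₗ[ℂ] W') (S : Set W) : zariskiDim (e '' S) = zariskiDim S := by
  let q : polyFun W' →+* polyFun W ⧸ idealOf (zariskiClosure S) :=
    (Ideal.Quotient.mk _).comp (polyFunCongr e : polyFun W' →+* polyFun W)
  have hq : Function.Surjective q :=
    Ideal.Quotient.mk_surjective.comp (polyFunCongr e).surjective
  have hker : RingHom.ker q = idealOf (zariskiClosure (e '' S)) := by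
    ext p
    rw [RingHom.mem_ker, mem_idealOf_zariskiClosure, Set.forall_mem_image]
    exact Ideal.Quotient.eq_zero_iff_mem.trans mem_idealOf_zariskiClosure
  rw [zariskiDim, zariskiDim, ringKrullDim_eq_of_ringEquiv
    (S := polyFun W ⧸ idealOf (zariskiClosure S)) <|
      (Ideal.quotEquivOfEq hker.symm).trans (RingHom.quotientKerEquivOfSurjective hq)]

/-- A representation transported along a linear isomorphism. -/
def transportRep (σ : Representation ℂ G W) (e : W ≃ₗ[ℂ] W') : Representation ℂ G W' where
  toFun g := e.toLinearMap ∘ₗ σ g ∘ₗ e.symm.toLinearMap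
  map_one' := by ext; simp
  map_mul' g h := by ext; simp

theorem transportRep_apply (σ : Representation ℂ G W) (e : W ≃ₗ[ℂ] W') (g : G) (w : W) :
    transportRep σ e g (e w) = e (σ g w) := by
  simp [transportRep]

theorem actsFaithfullyOn_image {S : Set W} (h : ActsFaithfullyOn σ S) (e : W ≃ₗ[ℂ] W') :
    ActsFaithfullyOn (transportRep σ e) (e '' S) := by
  intro g hg
  refine h g fun w hw => e.injective ?_
  rw [← transportRep_apply, hg _ ⟨w, hw, rfl⟩]

theorem isMorphism_transport {f : V → W} (hf : IsMorphism f) (d : V ≃ₗ[ℂ] V') (e : W ≃ₗ[ℂ] W') :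
    IsMorphism fun v => e (f (d.symm v)) := fun l =>
  polyFun_comp_linearMap (hf (l ∘ₗ e.toLinearMap)) d.symm.toLinearMap

theorem symm_transportRep_apply (ρ : Representation ℂ G V) (d : V ≃ₗ[ℂ] V') (g : G) (v : V') :
    d.symm (transportRep ρ d g v) = ρ g (d.symm v) := by
  simp [transportRep]

/-- `edim` only ranges over modules in `Type`; modules in other universes are compared with `Fin k →
ℂ` by choosing bases. -/
theorem edim_le [FiniteDimensional ℂ V] [FiniteDimensional ℂ W] (φ : RationalCovariant ρ σ)
    (hφ : φ.IsFaithful) : edim G ≤ φ.dim := by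
  let d : V ≃ₗ[ℂ] (Fin (Module.finrank ℂ V) → ℂ) := (Module.finBasis ℂ V).equivFun
  let e : W ≃ₗ[ℂ] (Fin (Module.finrank ℂ W) → ℂ) := (Module.finBasis ℂ W).equivFun
  let φ' : RationalCovariant (transportRep ρ d) (transportRep σ e) :=
    { num := fun v => e (φ.num (d.symm v))
      den := fun v => φ.den (d.symm v)
      num_isMorphism := isMorphism_transport φ.num_isMorphism d e
      den_mem := polyFun_comp_linearMap φ.den_mem d.symm.toLinearMap
      den_ne_zero := fun h => φ.den_ne_zero <| funext fun v => by
        simpa using congrFun h (d v)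
      equivariant := fun g v h h' => by
        rw [symm_transportRep_apply] at h' ⊢
        rw [← map_smul, ← map_smul, transportRep_apply, φ.equivariant g _ h h'] }
  have himg : φ'.toFun '' φ'.domain = e '' (φ.toFun '' φ.domain) := by
    ext w
    constructor
    · rintro ⟨v, hv, rfl⟩
      exact ⟨_, ⟨d.symm v, hv, rfl⟩, map_smul e _ _⟩
    · rintro ⟨_, ⟨v, hv, rfl⟩, rfl⟩
      refine ⟨d v, ?_, ?_⟩
      · simpa [φ', RationalCovariant.domain] using hv
      · simp [φ', RationalCovariant.toFun]
  refine Nat.sInf_le ⟨_, _, _, _, _, _, inferInstance, inferInstance, _, _, φ', ?_, ?_⟩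
  · rw [RationalCovariant.IsFaithful, himg]
    exact actsFaithfullyOn_image hφ e
  · rw [RationalCovariant.dim, himg, zariskiDim_image, RationalCovariant.dim]

theorem covdim_le [FiniteDimensional ℂ V] [FiniteDimensional ℂ W] (φ : Covariant ρ σ)
    (hφ : φ.IsFaithful) : covdim G ≤ φ.dim := by
  let d : V ≃ₗ[ℂ] (Fin (Module.finrank ℂ V) → ℂ) := (Module.finBasis ℂ V).equivFun
  let e : W ≃ₗ[ℂ] (Fin (Module.finrank ℂ W) → ℂ) := (Module.finBasis ℂ W).equivFun
  let φ' : Covariant (transportRep ρ d) (transportRep σ e) :=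
    { toFun := fun v => e (φ.toFun (d.symm v))
      isMorphism := isMorphism_transport φ.isMorphism d e
      equivariant := fun g v => by
        rw [symm_transportRep_apply, transportRep_apply, φ.equivariant] }
  have himg : Set.range φ'.toFun = e '' Set.range φ.toFun := by
    rw [← Set.range_comp, ← d.symm.surjective.range_comp (e ∘ φ.toFun)]
    rfl
  refine Nat.sInf_le ⟨_, _, _, _, _, _, inferInstance, inferInstance, _, _, φ', ?_, ?_⟩
  · rw [Covariant.IsFaithful, himg]
    exact actsFaithfullyOn_image hφ e
  · rw [Covariant.dim, himg, zariskiDim_image, Covariant.dim]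

end Transport

/-! ### From equivariant rational functions back to covariants -/

section Realization

variable {G V W : Type*} [Group G] [AddCommGroup V] [Module ℂ V] [AddCommGroup W] [Module ℂ W]
  {ρ : Representation ℂ G V} {σ : Representation ℂ G W}

/-- Any common denominator is replaced by its norm, the product of all its `G`-translates, which it
still divides. -/
theorem exists_invariant_denominator [Finite G] (ρ : Representation ℂ G V) {ι : Type*} [Finite ι]
    (x : ι → RatFun V) :
    ∃ (P : V → ℂ) (hP : P ∈ polyFun V), P ≠ 0 ∧ (∀ g v, P (ρ g v) = P v) ∧
      ∀ i, ∃ (f : V → ℂ) (hf : f ∈ polyFun V), toRat P hP * x i = toRat f hf := by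
  classical
  cases nonempty_fintype G
  obtain ⟨b, hb⟩ := IsLocalization.exist_integer_multiples_of_finite
    (nonZeroDivisors (polyFun V)) x
  let t : G → polyFun V := fun g => ⟨fun v => (b : polyFun V).1 (ρ g v),
    polyFun_comp_linearMap (b : polyFun V).2 (ρ g)⟩
  have ht : ∀ g, t g ≠ 0 := by
    intro g h
    refine nonZeroDivisors.coe_ne_zero b (Subtype.ext (funext fun v => ?_))
    have h1 := congrFun (congrArg Subtype.val h) (ρ g⁻¹ v)
    simpa [t, ← Module.End.mul_apply, ← map_mul] using h1
  have hval : ∀ v, ((∏ g, t g : polyFun V) : V → ℂ) v = ∏ g, (b : polyFun V).1 (ρ g v) := by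
    intro v
    simp [t]
  refine ⟨_, (∏ g, t g).2, ?_, fun g v => ?_, fun i => ?_⟩
  · exact fun h => Finset.prod_ne_zero_iff.mpr (fun g _ => ht g) (Subtype.ext h)
  · rw [hval, hval]
    refine Fintype.prod_equiv (Equiv.mulRight g) _ _ fun h => ?_
    simp
  · obtain ⟨y, hy⟩ := hb i
    have h1 : t 1 = b := Subtype.ext (funext fun v => by simp [t])
    have h2 : (∏ g, t g) = (∏ g ∈ Finset.univ.erase 1, t g) * b := by
      rw [← h1, Finset.prod_erase_mul _ _ (Finset.mem_univ _)]
    refine ⟨_, ((∏ g ∈ Finset.univ.erase 1, t g) * y).2, ?_⟩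
    change algebraMap (polyFun V) (RatFun V) (∏ g, t g) * x i =
      algebraMap (polyFun V) (RatFun V) ((∏ g ∈ Finset.univ.erase 1, t g) * y)
    rw [h2, map_mul, map_mul, hy, mul_assoc, Algebra.smul_def]

theorem toRat_sum {ι : Type*} (s : Finset ι) {f : ι → V → ℂ} (hf : ∀ i, f i ∈ polyFun V) :
    ∑ i ∈ s, toRat (f i) (hf i) =
      toRat (∑ i ∈ s, f i) ((polyFun V).sum_mem fun i _ => hf i) := by
  simp only [toRat]
  rw [← map_sum]
  congr 1
  exact Subtype.ext (by simp)

theorem exists_covariant_of_isEquivariant [Finite G] [FiniteDimensional ℂ W]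
    {Φ : Module.Dual ℂ W →ₗ[ℂ] RatFun V} (hΦ : IsEquivariant ρ σ Φ) :
    ∃ (M : Covariant ρ σ) (P : V → ℂ) (hP : P ∈ polyFun V), P ≠ 0 ∧ (∀ g v, P (ρ g v) = P v) ∧
      ∀ l, toRat (fun v => l (M.toFun v)) (M.isMorphism l) = toRat P hP * Φ l := by
  let b := Module.finBasis ℂ W
  obtain ⟨P, hP, hP0, hPinv, h⟩ := exists_invariant_denominator ρ fun i => Φ (b.coord i)
  choose f hf hfΦ using h
  let N : V → W := fun v => ∑ i, f i v • b i
  have hN : ∀ l : Module.Dual ℂ W, (fun v => l (N v)) = ∑ i, l (b i) • f i := by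
    intro l
    funext v
    simp [N, mul_comm]
  have hmem : ∀ (l : Module.Dual ℂ W) i, l (b i) • f i ∈ polyFun V :=
    fun l i => (polyFun V).smul_mem (hf i) _
  have hmor : IsMorphism N := fun l => by
    rw [hN]
    exact (polyFun V).sum_mem fun i _ => hmem l i
  have hNΦ : ∀ l : Module.Dual ℂ W, toRat (fun v => l (N v)) (hmor l) = toRat P hP * Φ l := by
    intro l
    conv_rhs => rw [← b.sum_dual_apply_smul_coord l, map_sum, Finset.mul_sum]
    simp only [hN, map_smul, mul_smul_comm, hfΦ, toRat_smul]
    rw [toRat_sum]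
  refine ⟨⟨N, hmor, fun g v => ?_⟩, P, hP, hP0, hPinv, hNΦ⟩
  rw [← sub_eq_zero, ← Module.forall_dual_apply_eq_zero_iff ℂ]
  intro l
  rw [map_sub, sub_eq_zero]
  have h1 := congrArg (ratRep ρ g⁻¹) (hNΦ l)
  rw [map_mul, hΦ, ratRep_toRat, ratRep_toRat, inv_inv] at h1
  simp only [hPinv] at h1
  rw [← hNΦ] at h1
  exact congrFun (toRat_inj.mp h1) v

theorem edim_le_trdeg_coordField [Finite G] [FiniteDimensional ℂ V] [FiniteDimensional ℂ W]
    {Φ : Module.Dual ℂ W →ₗ[ℂ] RatFun V} (hΦ : IsEquivariant ρ σ Φ)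
    (hf : IsGenericallyFaithful σ Φ) :
    edim G ≤ (Algebra.trdeg ℂ (coordField Φ)).toNat := by
  obtain ⟨M, P, hP, hP0, hPinv, h⟩ := exists_covariant_of_isEquivariant hΦ
  let φ : RationalCovariant ρ σ := ⟨M.toFun, P, M.isMorphism, hP, hP0, fun g v _ _ => by
    rw [hPinv, M.equivariant, map_smul]⟩
  have hφ : φ.generic = Φ := by
    ext l
    rw [φ.generic_apply, h l]
    exact mul_div_cancel_left₀ _ (mt toRat_eq_zero.mp hP0)
  rw [← hφ, ← φ.dim_eq_trdeg]
  exact edim_le φ (φ.isFaithful_iff.mpr (hφ ▸ hf))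

/-- With an invariant denominator `P`, the map `P • Φ` is a regular covariant, still faithful, and
its coordinates lie in the field of `Φ` extended by the single element `P`. -/
theorem covdim_le_trdeg_coordField_add_one [Finite G] [FiniteDimensional ℂ V]
    [FiniteDimensional ℂ W] {Φ : Module.Dual ℂ W →ₗ[ℂ] RatFun V} (hΦ : IsEquivariant ρ σ Φ)
    (hf : IsGenericallyFaithful σ Φ) :
    covdim G ≤ (Algebra.trdeg ℂ (coordField Φ)).toNat + 1 := by
  obtain ⟨M, P, hP, hP0, hPinv, h⟩ := exists_covariant_of_isEquivariant hΦ
  have hone : toRat (1 : V → ℂ) (polyFun V).one_mem = 1 :=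
    map_one (algebraMap (polyFun V) (RatFun V))
  have hM : ∀ l, M.toRational.generic l = toRat P hP * Φ l := by
    intro l
    rw [← h l, RationalCovariant.generic_apply]
    change _ / toRat (1 : V → ℂ) _ = _
    rw [hone, div_one]
    rfl
  have hfaith : M.IsFaithful := by
    rw [← M.toRational_isFaithful, RationalCovariant.isFaithful_iff]
    intro g hg
    refine hf g fun l => ?_
    have h1 := hg l
    rw [hM, hM] at h1
    exact mul_left_cancel₀ (mt toRat_eq_zero.mp hP0) h1
  refine (covdim_le M hfaith).trans ?_
  rw [← M.toRational_dim, RationalCovariant.dim_eq_trdeg]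
  refine le_trans ?_ (trdeg_toNat_adjoin_singleton_le trdeg_ratFun_lt_aleph0
    (coordField Φ) (toRat P hP))
  refine trdeg_toNat_mono trdeg_ratFun_lt_aleph0 (IntermediateField.adjoin_le_iff.mpr ?_)
  rintro _ ⟨l, rfl⟩
  rw [hM]
  exact mul_mem ((le_sup_right : _ ≤ coordField Φ ⊔ _)
    (IntermediateField.mem_adjoin_simple_self _ _)) ((le_sup_left : coordField Φ ≤ _)
    (mem_coordField _ _))

end Realization

/-! ### Weights of a torus action on a field -/

section Weights

variable {n : ℕ} {L : Type*} [Field L] [Algebra ℂ L] (τ : (Fin n → ℂˣ) →* (L ≃ₐ[ℂ] L))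

/-- The character of the torus with the given exponents. -/
noncomputable def torusChar (a : Fin n → ℤ) : (Fin n → ℂˣ) →* ℂ where
  toFun t := ∏ i, (t i : ℂ) ^ a i
  map_one' := by simp
  map_mul' t t' := by simp [mul_zpow, Finset.prod_mul_distrib]

theorem torusChar_apply (a : Fin n → ℤ) (t : Fin n → ℂˣ) :
    torusChar a t = ∏ i, (t i : ℂ) ^ a i := rfl

theorem torusChar_add (a b : Fin n → ℤ) (t : Fin n → ℂˣ) :
    torusChar (a + b) t = torusChar a t * torusChar b t := by
  simp [torusChar_apply, zpow_add₀, Finset.prod_mul_distrib]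

theorem torusChar_zero (t : Fin n → ℂˣ) : torusChar 0 t = 1 := by
  simp [torusChar_apply]

theorem torusChar_neg (a : Fin n → ℤ) (t : Fin n → ℂˣ) :
    torusChar (-a) t = (torusChar a t)⁻¹ := by
  simp [torusChar_apply]

theorem torusChar_mulSingle (a : Fin n → ℤ) (i : Fin n) (s : ℂˣ) :
    torusChar a (Pi.mulSingle i s) = (s : ℂ) ^ a i := by
  rw [torusChar_apply, Finset.prod_eq_single i]
  · simp
  · intro j _ hj
    simp [Pi.mulSingle_eq_of_ne hj]
  · simp

theorem torusChar_injective : Function.Injective (torusChar (n := n)) := by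
  intro a b h
  funext i
  have h2 : (2 : ℂ) ≠ 0 := two_ne_zero
  -- The integer powers of `2` have distinct norms, so one value recovers the exponent.
  have h1 := congrArg norm (DFunLike.congr_fun h (Pi.mulSingle i (Units.mk0 2 h2)))
  rw [torusChar_mulSingle, torusChar_mulSingle, norm_zpow, norm_zpow] at h1
  simp only [Units.val_mk0, Complex.norm_ofNat] at h1
  exact zpow_right_injective₀ (by norm_num) (by norm_num) h1

/-- The torus acts on `f` through the given character. -/
def HasWeight (a : Fin n → ℤ) (f : L) : Prop := ∀ t, τ t⁻¹ f = torusChar a t • f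

variable {τ}

theorem HasWeight.mul {a b : Fin n → ℤ} {f g : L} (hf : HasWeight τ a f) (hg : HasWeight τ b g) :
    HasWeight τ (a + b) (f * g) := fun t => by
  rw [map_mul, hf t, hg t, torusChar_add, smul_mul_smul_comm]

theorem HasWeight.inv {a : Fin n → ℤ} {f : L} (hf : HasWeight τ a f) :
    HasWeight τ (-a) f⁻¹ := fun t => by
  rw [map_inv₀, hf t, torusChar_neg, smul_inv₀]

theorem HasWeight.one : HasWeight τ 0 1 := fun t => by
  rw [map_one, torusChar_zero, one_smul]

theorem HasWeight.pow {a : Fin n → ℤ} {f : L} (hf : HasWeight τ a f) (k : ℕ) :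
    HasWeight τ (k • a) (f ^ k) := by
  induction k with
  | zero => simpa using HasWeight.one
  | succ k ih => rw [pow_succ, succ_nsmul]; exact ih.mul hf

theorem HasWeight.prod {ι : Type*} (s : Finset ι) {a : ι → Fin n → ℤ} {f : ι → L}
    (h : ∀ i, HasWeight τ (a i) (f i)) : HasWeight τ (∑ i ∈ s, a i) (∏ i ∈ s, f i) := by
  classical
  induction s using Finset.induction_on with
  | empty => simpa using HasWeight.one
  | insert i s hi ih => rw [Finset.prod_insert hi, Finset.sum_insert hi]; exact (h i).mul ih

theorem HasWeight.sum {ι : Type*} (s : Finset ι) {a : Fin n → ℤ} {f : ι → L}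
    (h : ∀ i ∈ s, HasWeight τ a (f i)) : HasWeight τ a (∑ i ∈ s, f i) := fun t => by
  rw [map_sum, Finset.smul_sum]
  exact Finset.sum_congr rfl fun i hi => h i hi t

theorem HasWeight.map {a : Fin n → ℤ} {f : L} (h : HasWeight τ a f) (e : L ≃ₐ[ℂ] L)
    (he : ∀ t x, τ t (e x) = e (τ t x)) : HasWeight τ a (e f) := fun t => by
  rw [he, h t, map_smul]

theorem hasWeight_of_mulSingle {a : Fin n → ℤ} {f : L}
    (h : ∀ i (s : ℂˣ), τ (Pi.mulSingle i s)⁻¹ f = (s : ℂ) ^ a i • f) : HasWeight τ a f := by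
  intro t
  rw [← Finset.univ_prod_mulSingle t]
  refine Finset.prod_induction _ (fun t => τ t⁻¹ f = torusChar a t • f) ?_ ?_ ?_
  · intro t t' ht ht'
    rw [mul_inv, map_mul, AlgEquiv.mul_apply, ht', map_smul, ht, map_mul, smul_smul, mul_comm]
  · simp
  · intro i _
    rw [h, torusChar_mulSingle]

variable (τ) in
/-- The field of elements of weight zero. -/
noncomputable def weightZero : IntermediateField ℂ L := IntermediateField.fixedField τ.range

theorem mem_weightZero {f : L} : f ∈ weightZero τ ↔ HasWeight τ 0 f := by
  rw [weightZero, IntermediateField.mem_fixedField_iff]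
  simp only [HasWeight, torusChar_zero, one_smul, MonoidHom.mem_range]
  constructor
  · exact fun h t => h _ ⟨_, rfl⟩
  · rintro h _ ⟨t, rfl⟩
    simpa using h t⁻¹

/-- Applying the torus to the relation gives a linear relation, with coefficients `f i`, between the
distinct characters `w i`; Dedekind's theorem applies. -/
theorem HasWeight.eq_zero_of_sum_eq_zero {ι : Type*} {s : Finset ι} {w : ι → Fin n → ℤ}
    (hw : Function.Injective w) {f : ι → L} (hf : ∀ i, HasWeight τ (w i) (f i))
    (h : ∑ i ∈ s, f i = 0) : ∀ i ∈ s, f i = 0 := by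
  let χ : ι → ((Fin n → ℂˣ) →* L) := fun i =>
    (algebraMap ℂ L : ℂ →* L).comp (torusChar (w i))
  have hχ : Function.Injective χ := by
    intro i j hij
    refine hw (torusChar_injective (MonoidHom.ext fun t => (algebraMap ℂ L).injective ?_))
    exact DFunLike.congr_fun hij t
  refine linearIndependent_iff'.mp ((linearIndependent_monoidHom (Fin n → ℂˣ) L).comp χ hχ) s f ?_
  funext t
  have h1 := congrArg (τ t⁻¹) h
  rw [map_sum, map_zero] at h1
  rw [Finset.sum_apply, Pi.zero_apply, ← h1]
  refine Finset.sum_congr rfl fun i _ => ?_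
  rw [hf i t, Algebra.smul_def (torusChar (w i) t), mul_comm]
  rfl

/-- Coefficients from `E` have weight zero, and independence of the `a k` gives different monomials
in `x` different weights. A polynomial relation therefore vanishes term by term. -/
theorem algebraicIndependent_of_hasWeight {ι : Type*} [Fintype ι] {a : ι → Fin n → ℤ}
    (ha : LinearIndependent ℚ fun k i => (a k i : ℚ)) {x : ι → L} (hx : ∀ k, x k ≠ 0)
    (hxa : ∀ k, HasWeight τ (a k) (x k)) {E : IntermediateField ℂ L} (hE : E ≤ weightZero τ) :
    AlgebraicIndependent E x := by
  rw [algebraicIndependent_iff]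
  intro p hp
  rw [MvPolynomial.aeval_def, MvPolynomial.eval₂_eq'] at hp
  have hw : Function.Injective fun d : ι →₀ ℕ => ∑ k, d k • a k := by
    intro d d' h
    have h1 : ∑ k, ((d k : ℚ) - d' k) • (fun i => (a k i : ℚ)) = 0 := by
      funext i
      have h2 := congrArg (Int.cast : ℤ → ℚ) (congrFun h i)
      simp only [Finset.sum_apply, nsmul_eq_mul, Int.cast_sum, Int.cast_mul,
        Pi.mul_apply, Pi.natCast_apply, Int.cast_natCast] at h2
      simp only [Finset.sum_apply, Pi.smul_apply, smul_eq_mul, Pi.zero_apply, sub_mul,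
        Finset.sum_sub_distrib, h2, sub_self]
    ext k
    have h3 := Fintype.linearIndependent_iff.mp ha _ h1 k
    exact_mod_cast sub_eq_zero.mp h3
  have hwt : ∀ d : ι →₀ ℕ, HasWeight τ (∑ k, d k • a k)
      (algebraMap E L (p.coeff d) * ∏ k, x k ^ d k) := by
    intro d
    rw [← zero_add (∑ k, d k • a k)]
    exact (mem_weightZero.mp (hE (p.coeff d).2)).mul
      (HasWeight.prod _ fun k => (hxa k).pow (d k))
  have h := HasWeight.eq_zero_of_sum_eq_zero hw hwt hp
  refine MvPolynomial.ext _ _ fun d => ?_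
  rw [MvPolynomial.coeff_zero]
  by_contra hd
  have h1 := h d (MvPolynomial.mem_support_iff.mpr hd)
  rcases mul_eq_zero.mp h1 with h2 | h2
  · exact hd ((map_eq_zero_iff _ (algebraMap E L).injective).mp h2)
  · exact Finset.prod_ne_zero_iff.mpr (fun k _ => pow_ne_zero _ (hx k)) h2

end Weights

/-! ### Nonvanishing traces -/

section Descent

variable {G L : Type*} [Group G] [Fintype G] [Field L] [Algebra ℂ L]

/-- The restrictions of the `α g` to `M` are distinct characters. If all the sums vanished, the `α g
x` would be coefficients of a linear relation between them, and the one at `g = 1` is `x ≠ 0`. -/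
theorem exists_sum_ne_zero (α : G →* (L ≃ₐ[ℂ] L)) {M : IntermediateField ℂ L}
    (hM : ∀ g : G, (∀ f ∈ M, α g f = f) → g = 1)
    {x : L} (hx : x ≠ 0) : ∃ f ∈ M, ∑ g, α g (x * f) ≠ 0 := by
  let χ : G → (M →* L) := fun g => (α g : L →* L).comp (M.val : M →* L)
  have hχ : Function.Injective χ := by
    intro g h hgh
    have h1 : h⁻¹ * g = 1 := by
      refine hM _ fun f hf => ?_
      have h2 : α g f = α h f := DFunLike.congr_fun hgh (⟨f, hf⟩ : M)
      rw [map_mul, AlgEquiv.mul_apply, h2, ← AlgEquiv.mul_apply, ← map_mul, inv_mul_cancel,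
        map_one, AlgEquiv.one_apply]
    exact (inv_mul_eq_one.mp h1).symm
  by_contra! h
  have h1 := Fintype.linearIndependent_iff.mp
    ((linearIndependent_monoidHom M L).comp χ hχ) (fun g => α g x) (by
      funext f
      rw [Finset.sum_apply, Pi.zero_apply, ← h f f.2]
      exact Finset.sum_congr rfl fun g _ => (map_mul (α g) x f).symm) 1
  rw [map_one] at h1
  exact hx h1

end Descent

/-! ### Eigenfunctions and irreducibility -/

section Scalars

variable {L W : Type*} [Field L] [Algebra ℂ L] [AddCommGroup W] [Module ℂ W]

theorem exists_eq_algebraMap_of_isAlgebraic {c : L} (hc : IsAlgebraic ℂ c) :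
    ∃ z : ℂ, algebraMap ℂ L z = c :=
  minpoly.mem_range_of_degree_eq_one ℂ c
    (IsAlgClosed.degree_eq_one_of_irreducible ℂ (minpoly.irreducible hc.isIntegral))

/-- A function `c` that is an eigenvalue of `S` is a root of the minimal polynomial of `S`, hence
algebraic over ℂ and so constant. Injectivity of `Φ` then turns the eigenvalue equation into one for
`S` itself. -/
theorem exists_eq_smul_of_eigen [FiniteDimensional ℂ W] {Φ : Module.Dual ℂ W →ₗ[ℂ] L}
    (hΦ : Function.Injective Φ) {l₀ : Module.Dual ℂ W} (hl₀ : Φ l₀ ≠ 0) {S : Module.End ℂ W} {c : L}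
    (h : ∀ l, Φ (l ∘ₗ S) = c * Φ l) : ∃ z : ℂ, ∀ w, S w = z • w := by
  have hp : ∀ p : Polynomial ℂ, ∀ l,
      Φ (l ∘ₗ Polynomial.aeval S p) = Polynomial.aeval c p * Φ l := by
    intro p
    induction p using Polynomial.induction_on' with
    | add p q hp hq =>
      intro l
      rw [map_add, map_add, LinearMap.comp_add, map_add, hp, hq, add_mul]
    | monomial k a =>
      intro l
      have hk : Φ (l ∘ₗ (S ^ k)) = c ^ k * Φ l := by
        induction k with
        | zero => simp [Module.End.one_eq_id]
        | succ k ih =>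
          rw [pow_succ, Module.End.mul_eq_comp, ← LinearMap.comp_assoc, h, ih, pow_succ]
          ring
      rw [Polynomial.aeval_monomial, Polynomial.aeval_monomial, ← Algebra.smul_def,
        ← Algebra.smul_def, LinearMap.comp_smul, map_smul, hk, smul_mul_assoc]
  have hc : IsAlgebraic ℂ c := by
    refine ⟨minpoly ℂ S, minpoly.ne_zero (Algebra.IsIntegral.isIntegral S), ?_⟩
    have h1 := hp (minpoly ℂ S) l₀
    rw [minpoly.aeval, LinearMap.comp_zero, map_zero] at h1
    exact (mul_eq_zero.mp h1.symm).resolve_right hl₀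
  obtain ⟨z, rfl⟩ := exists_eq_algebraMap_of_isAlgebraic hc
  refine ⟨z, fun w => ?_⟩
  rw [← sub_eq_zero, ← Module.forall_dual_apply_eq_zero_iff ℂ]
  intro l
  have h1 : Φ (l ∘ₗ S) = Φ (z • l) := by rw [h, map_smul, Algebra.smul_def]
  have h2 := LinearMap.congr_fun (hΦ h1) w
  simpa [sub_eq_zero] using h2

/-- The common zeros in `W` of the forms in the kernel of `Φ` form a subrepresentation, and a
subspace of the dual is determined by its common zeros. -/
theorem injective_of_isIrreducible {G : Type*} [Group G] [FiniteDimensional ℂ W]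
    {σ : Representation ℂ G W} (hσ : σ.IsIrreducible) {Φ : Module.Dual ℂ W →ₗ[ℂ] L} (hΦ : Φ ≠ 0)
    (hker : ∀ g l, Φ l = 0 → Φ (l ∘ₗ σ g) = 0) : Function.Injective Φ := by
  let U : Subrepresentation σ := ⟨Φ.ker.dualCoannihilator, fun g w hw => by
    rw [Submodule.mem_dualCoannihilator] at hw ⊢
    exact fun l hl => hw (l ∘ₗ σ g) (hker g l hl)⟩
  have hann : Φ.ker.dualCoannihilator.dualAnnihilator = Φ.ker :=
    Subspace.dualCoannihilator_dualAnnihilator_eq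
  rcases hσ.eq_bot_or_eq_top U with h | h
  · have h1 : Φ.ker.dualCoannihilator = ⊥ := congrArg Subrepresentation.toSubmodule h
    rw [h1, Submodule.dualAnnihilator_bot] at hann
    exact absurd (LinearMap.ker_eq_top.mp hann.symm) hΦ
  · have h1 : Φ.ker.dualCoannihilator = ⊤ := congrArg Subrepresentation.toSubmodule h
    rw [h1, Submodule.dualAnnihilator_top] at hann
    exact LinearMap.ker_eq_bot.mp hann.symm

end Scalars

/-! ### Reduction to weight zero -/

section Reduction

variable {G X : Type*} [Group G] [AddCommGroup X] [Module ℂ X] {ρ : Representation ℂ G X}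
  {m : ℕ} {W : Fin m → Type*} [∀ j, AddCommGroup (W j)] [∀ j, Module ℂ (W j)]
  {σ : ∀ j, Representation ℂ G (W j)}

/-- A component of a vector valued rational function. -/
noncomputable def component (Φ : Module.Dual ℂ (∀ j, W j) →ₗ[ℂ] RatFun X) (j : Fin m) :
    Module.Dual ℂ (W j) →ₗ[ℂ] RatFun X :=
  Φ ∘ₗ (LinearMap.proj j : (∀ j, W j) →ₗ[ℂ] W j).dualMap

theorem component_apply (Φ : Module.Dual ℂ (∀ j, W j) →ₗ[ℂ] RatFun X) (j : Fin m)
    (l : Module.Dual ℂ (W j)) : component Φ j l = Φ (l ∘ₗ LinearMap.proj j) := rfl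

theorem apply_eq_sum_component (Φ : Module.Dual ℂ (∀ j, W j) →ₗ[ℂ] RatFun X)
    (l : Module.Dual ℂ (∀ j, W j)) :
    Φ l = ∑ j, component Φ j (l ∘ₗ LinearMap.single ℂ W j) := by
  simp only [component_apply]
  rw [← map_sum]
  congr 1
  refine LinearMap.ext fun w => ?_
  rw [LinearMap.sum_apply]
  simp only [LinearMap.comp_apply, LinearMap.proj_apply]
  rw [← map_sum]
  congr 1
  exact (Finset.univ_sum_single w).symm

theorem isEquivariant_component {Φ : Module.Dual ℂ (∀ j, W j) →ₗ[ℂ] RatFun X}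
    (hΦ : IsEquivariant ρ (sumRep σ) Φ) (j : Fin m) : IsEquivariant ρ (σ j) (component Φ j) :=
  fun g l => hΦ g (l ∘ₗ LinearMap.proj j)

theorem isEquivariant_of_component {Φ : Module.Dual ℂ (∀ j, W j) →ₗ[ℂ] RatFun X}
    (h : ∀ j, IsEquivariant ρ (σ j) (component Φ j)) : IsEquivariant ρ (sumRep σ) Φ := by
  intro g l
  rw [apply_eq_sum_component, apply_eq_sum_component Φ (l ∘ₗ _), map_sum]
  refine Finset.sum_congr rfl fun j _ => ?_
  rw [h j]
  congr 1
  refine LinearMap.ext fun w => congrArg l ?_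
  funext k
  by_cases hk : k = j
  · subst hk
    simp [sumRep]
  · simp [sumRep, hk]

theorem fixes_iff_component (Φ : Module.Dual ℂ (∀ j, W j) →ₗ[ℂ] RatFun X) (g : G) :
    (∀ l, Φ (l ∘ₗ sumRep σ g) = Φ l) ↔
      ∀ j l, component Φ j (l ∘ₗ σ j g) = component Φ j l := by
  constructor
  · exact fun h j l => h (l ∘ₗ LinearMap.proj j)
  · intro h l
    rw [apply_eq_sum_component, apply_eq_sum_component Φ l]
    refine Finset.sum_congr rfl fun j _ => ?_
    refine (congrArg (component Φ j) ?_).trans (h j (l ∘ₗ LinearMap.single ℂ W j))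
    refine LinearMap.ext fun w => congrArg l ?_
    funext k
    by_cases hk : k = j
    · subst hk
      simp [sumRep]
    · simp [sumRep, hk]

theorem component_mem_coordField (Φ : Module.Dual ℂ (∀ j, W j) →ₗ[ℂ] RatFun X) (j : Fin m)
    (l : Module.Dual ℂ (W j)) : component Φ j l ∈ coordField Φ :=
  mem_coordField _ _

variable {n : ℕ} {τ : (Fin n → ℂˣ) →* (RatFun X ≃ₐ[ℂ] RatFun X)}
  {Φ : Module.Dual ℂ (∀ j, W j) →ₗ[ℂ] RatFun X} {A : Matrix (Fin m) (Fin n) ℤ}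

/-- Scalars commute with every `σ j g`, so the commutators of `k` act trivially and faithfulness
kills them. -/
theorem mem_center_of_forall_scalar (hf : IsGenericallyFaithful (sumRep σ) Φ) {k : G}
    (hk : ∀ j, ∃ z : ℂ, ∀ w, σ j k w = z • w) : k ∈ Subgroup.center G := by
  refine Subgroup.mem_center_iff.mpr fun g => ?_
  have h : g⁻¹ * k⁻¹ * g * k = 1 := by
    refine hf _ ((fixes_iff_component Φ _).mpr fun j l => ?_)
    congr 1
    refine LinearMap.ext fun w => congrArg l ?_
    obtain ⟨z, hz⟩ := hk j
    have hz' : ∀ u, z • σ j k⁻¹ u = u := fun u => by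
      rw [← hz, ← Module.End.mul_apply, ← map_mul, mul_inv_cancel, map_one, Module.End.one_apply]
    rw [map_mul, Module.End.mul_apply, hz, map_smul, mul_assoc, map_mul, map_mul,
      Module.End.mul_apply, Module.End.mul_apply, ← map_smul, hz', ← Module.End.mul_apply,
      ← map_mul, inv_mul_cancel, map_one, Module.End.one_apply]
  have h1 : g⁻¹ * k⁻¹ * g * k = (k * g)⁻¹ * (g * k) := by group
  rw [h1] at h
  exact (inv_mul_eq_one.mp h).symm

/-- This is where the trivial center enters. Quotients of two coordinates of the same component have
weight zero, and fixing them all forces scalar action on each `W j`. -/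
theorem eq_one_of_fixes_weightZero [∀ j, FiniteDimensional ℂ (W j)]
    (hG : Subgroup.center G = ⊥) (hσ : ∀ j, (σ j).IsIrreducible)
    (hΦ : IsEquivariant ρ (sumRep σ) Φ) (hf : IsGenericallyFaithful (sumRep σ) Φ)
    (hne : ∀ j, component Φ j ≠ 0) (hwt : ∀ j l, HasWeight τ (A j) (component Φ j l)) {k : G}
    (hk : ∀ f ∈ coordField Φ ⊓ weightZero τ, ratRep ρ k f = f) : k = 1 := by
  suffices h : k⁻¹ ∈ Subgroup.center G by
    rw [hG, Subgroup.mem_bot, inv_eq_one] at h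
    exact h
  refine mem_center_of_forall_scalar hf fun j => ?_
  have hE := isEquivariant_component hΦ j
  have hinj : Function.Injective (component Φ j) := by
    refine injective_of_isIrreducible (hσ j) (hne j) fun g l hl => ?_
    have h1 := hE g⁻¹ l
    rw [hl, map_zero, inv_inv] at h1
    exact h1.symm
  obtain ⟨l₀, hl₀⟩ : ∃ l₀, component Φ j l₀ ≠ 0 := by
    by_contra! h
    exact hne j (LinearMap.ext h)
  -- The factor by which `k` multiplies `l₀` is a rational function; invariance of the quotients
  -- makes it the same for every `l`.
  refine exists_eq_smul_of_eigen hinj hl₀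
    (c := component Φ j (l₀ ∘ₗ σ j k⁻¹) / component Φ j l₀) fun l => ?_
  have h1 := hk (component Φ j l / component Φ j l₀) ⟨div_mem (component_mem_coordField Φ j l)
    (component_mem_coordField Φ j l₀), mem_weightZero.mpr (by
      rw [div_eq_mul_inv, ← add_neg_cancel (A j)]
      exact (hwt j l).mul (hwt j l₀).inv)⟩
  rw [map_div₀, hE, hE] at h1
  have h2 : component Φ j (l₀ ∘ₗ σ j k⁻¹) ≠ 0 := by
    rw [← hE]
    exact (map_ne_zero_iff _ (ratRep ρ k).injective).mpr hl₀
  rw [div_eq_div_iff h2 hl₀] at h1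
  field_simp
  linear_combination h1

theorem exists_invariant_of_weight [Finite G] [∀ j, FiniteDimensional ℂ (W j)]
    (hG : Subgroup.center G = ⊥) (hσ : ∀ j, (σ j).IsIrreducible)
    (hΦ : IsEquivariant ρ (sumRep σ) Φ) (hf : IsGenericallyFaithful (sumRep σ) Φ)
    (hne : ∀ j, component Φ j ≠ 0) (hwt : ∀ j l, HasWeight τ (A j) (component Φ j l))
    (hτ : ∀ g t x, τ t (ratRep ρ g x) = ratRep ρ g (τ t x)) (j : Fin m) :
    ∃ h ∈ coordField Φ, h ≠ 0 ∧ HasWeight τ (A j) h ∧ ∀ g, ratRep ρ g h = h := by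
  cases nonempty_fintype G
  obtain ⟨l, hl⟩ : ∃ l, component Φ j l ≠ 0 := by
    by_contra! h
    exact hne j (LinearMap.ext h)
  -- The average of a coordinate alone may vanish; a factor `f` of weight zero repairs this without
  -- changing the weight.
  obtain ⟨f, hfM, hsum⟩ := exists_sum_ne_zero (ratRep ρ)
    (fun k hk => eq_one_of_fixes_weightZero hG hσ hΦ hf hne hwt hk) hl
  refine ⟨_, sum_mem fun g _ => ?_, hsum, HasWeight.sum _ fun g _ => ?_, fun g => ?_⟩
  · exact mem_coordField_of_isEquivariant hΦ g
      (mul_mem (component_mem_coordField Φ j l) hfM.1)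
  · refine HasWeight.map ?_ _ fun t x => hτ g t x
    rw [← add_zero (A j)]
    exact (hwt j l).mul (mem_weightZero.mp hfM.2)
  · rw [map_sum]
    refine Fintype.sum_equiv (Equiv.mulLeft g) _ _ fun k => ?_
    rw [Equiv.coe_mulLeft, map_mul (ratRep ρ) g k, AlgEquiv.mul_apply]

/-- Dividing each component by an invariant of the same weight leaves equivariance and faithfulness
intact and removes the weight. -/
theorem exists_weightZero_covariant [Finite G] [∀ j, FiniteDimensional ℂ (W j)]
    (hG : Subgroup.center G = ⊥) (hσ : ∀ j, (σ j).IsIrreducible)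
    (hΦ : IsEquivariant ρ (sumRep σ) Φ) (hf : IsGenericallyFaithful (sumRep σ) Φ)
    (hne : ∀ j, component Φ j ≠ 0) (hwt : ∀ j l, HasWeight τ (A j) (component Φ j l))
    (hτ : ∀ g t x, τ t (ratRep ρ g x) = ratRep ρ g (τ t x)) :
    ∃ Ψ : Module.Dual ℂ (∀ j, W j) →ₗ[ℂ] RatFun X, IsEquivariant ρ (sumRep σ) Ψ ∧
      IsGenericallyFaithful (sumRep σ) Ψ ∧ coordField Ψ ≤ coordField Φ ⊓ weightZero τ := by
  choose h hmem h0 hw hinv using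
    exists_invariant_of_weight hG hσ hΦ hf hne hwt hτ
  let Ψ : Module.Dual ℂ (∀ j, W j) →ₗ[ℂ] RatFun X :=
    ∑ j, LinearMap.mulLeft ℂ (h j)⁻¹ ∘ₗ component Φ j ∘ₗ (LinearMap.single ℂ W j).dualMap
  have hΨ : ∀ j l, component Ψ j l = (h j)⁻¹ * component Φ j l := by
    intro j l
    rw [component_apply]
    simp only [Ψ, LinearMap.sum_apply, LinearMap.comp_apply, LinearMap.mulLeft_apply]
    rw [Finset.sum_eq_single j]
    · congr 2
      refine LinearMap.ext fun w => ?_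
      simp
    · intro k _ hk
      have h1 : (LinearMap.single ℂ W k).dualMap (l ∘ₗ LinearMap.proj j) = 0 := by
        refine LinearMap.ext fun w => ?_
        simp [hk.symm]
      rw [h1, map_zero, mul_zero]
    · simp
  refine ⟨Ψ, isEquivariant_of_component fun j g l => ?_, fun g hg => hf g ?_,
    IntermediateField.adjoin_le_iff.mpr ?_⟩
  · rw [hΨ, hΨ, map_mul, map_inv₀, hinv, isEquivariant_component hΦ j]
  · rw [fixes_iff_component] at hg ⊢
    intro j l
    have h1 := hg j l
    rw [hΨ, hΨ] at h1
    exact mul_left_cancel₀ (inv_ne_zero (h0 j)) h1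
  · rintro _ ⟨l, rfl⟩
    rw [apply_eq_sum_component]
    refine sum_mem fun j _ => ?_
    rw [hΨ]
    refine ⟨mul_mem (inv_mem (hmem j)) (component_mem_coordField Φ j _), mem_weightZero.mpr ?_⟩
    rw [← neg_add_cancel (A j)]
    exact (hw j).inv.mul (hwt j _)

theorem exists_linearIndependent_rows (A : Matrix (Fin m) (Fin n) ℤ) :
    ∃ r : Fin (intRank A) → Fin m, LinearIndependent ℚ fun k i => (A (r k) i : ℚ) := by
  obtain ⟨κ, a, ha, hspan, hli⟩ :=
    exists_linearIndependent' ℚ (A.map (Int.cast : ℤ → ℚ)).row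
  have : Finite κ := Finite.of_injective a ha
  cases nonempty_fintype κ
  have hcard : Fintype.card κ = intRank A := by
    rw [intRank, Matrix.rank_eq_finrank_span_row, ← hspan]
    exact (finrank_span_eq_card hli).symm
  let e : Fin (intRank A) ≃ κ := (Fintype.equivFinOfCardEq hcard).symm
  exact ⟨a ∘ e, hli.comp e e.injective⟩

/-- One nonzero coordinate is taken from each component in a maximal set with linearly independent
rows of `A`. -/
theorem trdeg_add_intRank_le [FiniteDimensional ℂ X] (hne : ∀ j, component Φ j ≠ 0)
    (hwt : ∀ j l, HasWeight τ (A j) (component Φ j l)) {E : IntermediateField ℂ (RatFun X)}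
    (hE : E ≤ coordField Φ ⊓ weightZero τ) :
    (Algebra.trdeg ℂ E).toNat + intRank A ≤ (Algebra.trdeg ℂ (coordField Φ)).toNat := by
  obtain ⟨r, hr⟩ := exists_linearIndependent_rows A
  have hl : ∀ j, ∃ l, component Φ j l ≠ 0 := by
    intro j
    by_contra! h
    exact hne j (LinearMap.ext h)
  choose l hl using hl
  have h := trdeg_toNat_add_card_le trdeg_ratFun_lt_aleph0 (hE.trans inf_le_left)
    (algebraicIndependent_of_hasWeight hr (x := fun k => component Φ (r k) (l (r k)))
      (fun k => hl (r k)) (fun k => hwt (r k) _) (hE.trans inf_le_right))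
    (fun k => component_mem_coordField Φ _ _)
  simpa using h

end Reduction

/-! ### Multihomogeneous covariants -/

section Multihomogeneous

variable {G : Type*} [Group G] {n m : ℕ} {V : Fin n → Type*} {W : Fin m → Type*}
  [∀ i, AddCommGroup (V i)] [∀ i, Module ℂ (V i)]
  [∀ j, AddCommGroup (W j)] [∀ j, Module ℂ (W j)]
  {ρ : ∀ i, Representation ℂ G (V i)} {σ : ∀ j, Representation ℂ G (W j)}
  {A : Matrix (Fin m) (Fin n) ℤ}

/-- The torus acting on a direct sum by rescaling its summands. -/
noncomputable def torusRep (V : Fin n → Type*) [∀ i, AddCommGroup (V i)] [∀ i, Module ℂ (V i)] :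
    Representation ℂ (Fin n → ℂˣ) (∀ i, V i) where
  toFun t := LinearMap.pi fun i => (t i : ℂ) • LinearMap.proj i
  map_one' := by ext; simp
  map_mul' t t' := by ext; simp [mul_smul]

theorem torusRep_apply (t : Fin n → ℂˣ) (v : ∀ i, V i) (i : Fin n) :
    torusRep V t v i = (t i : ℂ) • v i := rfl

theorem torusRep_mulSingle (i : Fin n) (s : ℂˣ) (v : ∀ i, V i) :
    torusRep V (Pi.mulSingle i s) v = Function.update v i ((s : ℂ) • v i) := by
  funext k
  rw [torusRep_apply]
  by_cases hk : k = i
  · subst hk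
    simp
  · simp [hk]

theorem ratRep_torusRep_comm (ρ : ∀ i, Representation ℂ G (V i)) (g : G) (t : Fin n → ℂˣ)
    (x : RatFun (∀ i, V i)) :
    ratRep (torusRep V) t (ratRep (sumRep ρ) g x) =
      ratRep (sumRep ρ) g (ratRep (torusRep V) t x) := by
  have h : Commute (ratRep (torusRep V) t) (ratRep (sumRep ρ) g) := by
    refine Commute.map (f := ratAct) (Units.ext ?_)
    refine LinearMap.ext fun v => ?_
    funext i
    change (t i : ℂ) • ρ i g (v i) = ρ i g ((t i : ℂ) • v i)
    rw [map_smul]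
  exact DFunLike.congr_fun h.eq x

theorem component_generic_ne_zero {φ : RationalCovariant (sumRep ρ) (sumRep σ)}
    (h : IsMultihomogeneousOn φ.domain φ.toFun A) (j : Fin m) :
    component φ.generic j ≠ 0 := by
  intro h0
  obtain ⟨v, hv, hne⟩ := h.1 j
  refine hne ?_
  have hnum : φ.num v j = 0 := by
    rw [← Module.forall_dual_apply_eq_zero_iff ℂ]
    intro l
    have h1 := LinearMap.congr_fun h0 l
    rw [component_apply, RationalCovariant.generic_apply, LinearMap.zero_apply,
      div_eq_zero_iff, or_iff_left φ.toRat_den_ne_zero, toRat_eq_zero] at h1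
    exact congrFun h1 v
  simp [RationalCovariant.toFun, hnum]

theorem hasWeight_component_generic {φ : RationalCovariant (sumRep ρ) (sumRep σ)}
    (h : IsMultihomogeneousOn φ.domain φ.toFun A) (j : Fin m) (l : Module.Dual ℂ (W j)) :
    HasWeight (ratRep (torusRep V)) (A j) (component φ.generic j l) := by
  -- Multihomogeneity rescales one summand at a time, which suffices because these elements generate
  -- the torus.
  refine hasWeight_of_mulSingle fun i s => ?_
  have hne : (fun v => φ.den (torusRep V (Pi.mulSingle i s)⁻¹⁻¹ v)) ≠ 0 := by
    intro h0
    refine φ.den_ne_zero (funext fun v => ?_)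
    have := congrFun h0 (torusRep V (Pi.mulSingle i s)⁻¹ v)
    simpa [← Module.End.mul_apply, ← map_mul] using this
  rw [component_apply, RationalCovariant.generic_apply, map_div₀, ratRep_toRat, ratRep_toRat,
    ← smul_div_assoc, toRat_smul, toRat_div_eq_iff _ _ _ _ hne φ.den_ne_zero]
  intro v h1 h2
  rw [inv_inv, torusRep_mulSingle] at h1 ⊢
  have h3 := congrArg l (h.2 j i s s.ne_zero v h2 h1)
  simp only [RationalCovariant.toFun, Pi.smul_apply, map_smul, smul_eq_mul] at h3
  simp only [LinearMap.comp_apply, LinearMap.proj_apply, Pi.smul_apply, smul_eq_mul]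
  rw [h3]
  ring

theorem edim_covdim_le_of_multihomogeneous [Finite G] [∀ i, FiniteDimensional ℂ (V i)]
    [∀ j, FiniteDimensional ℂ (W j)] (hG : Subgroup.center G = ⊥)
    (hσ : ∀ j, (σ j).IsIrreducible) (φ : RationalCovariant (sumRep ρ) (sumRep σ))
    (hf : φ.IsFaithful) (h : IsMultihomogeneousOn φ.domain φ.toFun A) :
    edim G + intRank A ≤ φ.dim ∧ covdim G + intRank A ≤ φ.dim + 1 := by
  have hne := component_generic_ne_zero h
  have hwt := hasWeight_component_generic h
  obtain ⟨Ψ, hΨ, hΨf, hle⟩ := exists_weightZero_covariant hG hσ φ.isEquivariant_generic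
    (φ.isFaithful_iff.mp hf) hne hwt (ratRep_torusRep_comm ρ)
  have h1 := trdeg_add_intRank_le hne hwt hle
  rw [← φ.dim_eq_trdeg] at h1
  have h2 := edim_le_trdeg_coordField hΨ hΨf
  have h3 := covdim_le_trdeg_coordField_add_one hΨ hΨf
  lia

/-- Along the `i`-th summand `f` is polynomial in the scaling factor `s` and constant for `s ≠ 0`,
hence also at `s = 0`. Summands can thus be set to zero one by one. Regularity is essential:
rational maps of degree zero need not be constant. -/
theorem apply_eq_apply_zero_of_degree_zero {f : (∀ i, V i) → ∀ j, W j} (hf : IsMorphism f)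
    (h : IsMultihomogeneousOn Set.univ f (0 : Matrix (Fin m) (Fin n) ℤ)) (v : ∀ i, V i) :
    f v = f 0 := by
  have hstep : ∀ (v : ∀ i, V i) i, f (Function.update v i 0) = f v := by
    intro v i
    rw [← sub_eq_zero, ← Module.forall_dual_apply_eq_zero_iff ℂ]
    intro l
    obtain ⟨p, hp⟩ := exists_polynomial_eval_line (hf l) (Function.update v i 0)
      (Pi.single i (v i))
    have hline : ∀ s : ℂ, Function.update v i 0 + s • Pi.single i (v i) =
        Function.update v i (s • v i) := by
      intro s
      funext k
      by_cases hk : k = i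
      · subst hk
        simp
      · simp [hk]
    have hpc : p = Polynomial.C (l (f v)) := by
      refine Polynomial.eq_of_infinite_eval_eq _ _
        ((Set.finite_singleton (0 : ℂ)).infinite_compl.mono fun s hs => ?_)
      have h1 : f (Function.update v i (s • v i)) = f v := funext fun j => by
        simpa using h.2 j i s hs v trivial trivial
      rw [Set.mem_ofPred_eq, ← hp, hline, h1, Polynomial.eval_C]
    have h0 := hp 0
    rw [hpc, Polynomial.eval_C, hline, zero_smul] at h0
    rw [map_sub, h0, sub_self]
  have hset : ∀ s : Finset (Fin n), f (fun i => if i ∈ s then 0 else v i) = f v := by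
    intro s
    induction s using Finset.induction_on with
    | empty => simp
    | insert a s _ ih =>
      rw [← ih, ← hstep (fun i => if i ∈ s then 0 else v i) a]
      congr 1
      funext k
      by_cases hk : k = a
      · subst hk
        simp
      · simp [hk]
  rw [← hset Finset.univ]
  congr 1
  funext i
  simp

theorem eq_zero_of_intRank_eq_zero (h : intRank A = 0) : A = 0 := by
  rw [intRank, Matrix.rank_eq_finrank_span_row, Submodule.finrank_eq_zero,
    Submodule.span_eq_bot] at h
  ext j i
  have h1 : (A j i : ℚ) = 0 := congrFun (h _ ⟨j, rfl⟩) i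
  exact_mod_cast h1

/-- The image of a constant covariant is a single point fixed by all of `G`. -/
theorem intRank_ne_zero_of_nontrivial [Nontrivial G] {φ : Covariant (sumRep ρ) (sumRep σ)}
    (hf : φ.IsFaithful) (h : IsMultihomogeneousOn Set.univ φ.toFun A) : intRank A ≠ 0 := by
  intro h0
  obtain rfl := eq_zero_of_intRank_eq_zero h0
  have hconst := apply_eq_apply_zero_of_degree_zero φ.isMorphism h
  obtain ⟨g, hg⟩ := exists_ne (1 : G)
  refine hg (hf g ?_)
  rintro _ ⟨v, rfl⟩
  rw [← φ.equivariant, hconst, ← hconst v]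

end Multihomogeneous

end CovDim

/-! ### The main theorem -/

theorem proposition3p3 {G : Type*} [Group G] [Finite G] (hG : Subgroup.center G = ⊥)
    {n m : ℕ} {V : Fin n → Type*} {W : Fin m → Type*}
    [∀ i, AddCommGroup (V i)] [∀ i, Module ℂ (V i)] [∀ i, FiniteDimensional ℂ (V i)]
    [∀ j, AddCommGroup (W j)] [∀ j, Module ℂ (W j)] [∀ j, FiniteDimensional ℂ (W j)]
    (ρ : ∀ i, Representation ℂ G (V i)) (σ : ∀ j, Representation ℂ G (W j))
    (hρ : ∀ i, (ρ i).IsIrreducible) (hσ : ∀ j, (σ j).IsIrreducible)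
    (A : Matrix (Fin m) (Fin n) ℤ) :
    (∀ φ : CovDim.Covariant (CovDim.sumRep ρ) (CovDim.sumRep σ), φ.IsFaithful →
      CovDim.IsMultihomogeneousOn Set.univ φ.toFun A →
        (CovDim.edim G : ℤ) ≤ φ.dim - CovDim.intRank A ∧
        (CovDim.covdim G : ℤ) ≤ φ.dim - CovDim.intRank A + 1 ∧
        (Nontrivial G → φ.dim = CovDim.covdim G → CovDim.intRank A = 1)) ∧
    (∀ φ : CovDim.RationalCovariant (CovDim.sumRep ρ) (CovDim.sumRep σ), φ.IsFaithful →
      CovDim.IsMultihomogeneousOn φ.domain φ.toFun A →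
        (CovDim.edim G : ℤ) ≤ φ.dim - CovDim.intRank A ∧
        (CovDim.covdim G : ℤ) ≤ φ.dim - CovDim.intRank A + 1 ∧
        (φ.dim = CovDim.edim G → A = 0)) := by
  refine ⟨fun φ hφ h => ?_, fun φ hφ h => ?_⟩
  · obtain ⟨h1, h2⟩ := CovDim.edim_covdim_le_of_multihomogeneous hG hσ φ.toRational
      (φ.toRational_isFaithful.mpr hφ)
      (by rwa [φ.toRational_domain, φ.toRational_toFun])
    rw [φ.toRational_dim] at h1 h2
    refine ⟨by lia, by lia, fun _ hdim => ?_⟩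
    -- Minimality and the covdim bound leave rank `0` or `1`.
    have h3 := CovDim.intRank_ne_zero_of_nontrivial hφ h
    lia
  · obtain ⟨h1, h2⟩ := CovDim.edim_covdim_le_of_multihomogeneous hG hσ φ hφ h
    exact ⟨by lia, by lia, fun hdim => CovDim.eq_zero_of_intRank_eq_zero (by lia)⟩
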